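/- Fix an integer $r\ge 1$. For $g\ge 0$, $n\ge 1$ and $\vec\mu=(\mu_1,\dots,\mu_n)\in\mathbb{Z}_+^n$ let $H_{g,n}^{(r)}(\vec\mu)$ be the orbifold Hurwitz number: the automorphism-weighted count of connected branched coverings of $\mathbb{P}^1$ by curves of genus $g$ with $n$ labelled poles of orders $\mu_1,\dots,\mu_n$, all zeros unlabelled and of order exactly $r$, and $s=2g-2+n+(\mu_1+\cdots+\mu_n)/r$ further unlabelled simple branch points. In terms of monodromy, with $d=\mu_1+\cdots+\mu_n$, it is $\frac{1}{d!\,s!}$ times the number of tuples consisting of a permutation $\alpha\in\mathfrak S_d$ all of whose cycles have length $r$, transpositions $\tau_1,\dots,\tau_s\in\mathfrak S_d$, and a labelling by $1,\dots,n$ of the cycles of $\alpha\tau_1\cdots\tau_s$ such that the $i$-th cycle has length $\mu_i$, where $\alpha,\tau_1,\dots,\tau_s$ generate a transitive subgroup. Put $$F_{g,n}^{(r)}(z_1,\dots,z_n)=\sum_{\vec\mu\in\mathbb{Z}_+^n}H_{g,n}^{(r)}(\vec\mu)\prod_{i=1}^n x_i^{\mu_i},\qquad x_i=z_ie^{-z_i^r},$$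 a formal power series in $z_1,\dots,z_n$, and define the partition function $$Z^{(r)}(z,\hbar)=\exp\Big(\sum_{g\ge 0}\sum_{n\ge 1}\frac{1}{n!}\hbar^{2g-2+n}F_{g,n}^{(r)}(z,\dots,z)\Big)\in\mathbb{C}((\hbar))[[z]].$$ Let $x=e^{-w}=ze^{-z^r}$ and $D=\frac{z}{1-rz^r}\frac{\partial}{\partial z}$, and consider the operators $$P=\hbar D-e^{r(-w+\frac{r-1}{2}\hbar)}e^{r\hbar D},\qquad Q=\frac{\hbar}{2}D^2-\Big(\frac1r+\frac{\hbar}{2}\Big)D-\hbar\frac{\partial}{\partial\hbar}$$ on $\mathbb{C}((\hbar))[[z]]$, where $e^{r\hbar D}=\sum_k (r\hbar D)^k/k!$. Then: 1. $P\,Z^{(r)}=0$ and $Q\,Z^{(r)}=0$; moreover $D=x\frac{\partial}{\partial x}$. 2. $[P,Q]=PQ-QP=P$. 3. The semi-classical limit of each of the two equations recovers the $r$-Lambert curve. Precisely, for every $\Psi=\exp\big(\sum_{m\ge 0}\hbar^{m-1}S_m(z)\big)$ with $S_m\in z\mathbb{C}[[z]]$, and with $y=DS_0$, $$\Psi^{-1}P\Psi=\big(y-x^re^{ry}\big)+O(\hbar),\qquad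 \Psi^{-1}Q\Psi=\hbar^{-1}\Big(\tfrac12y^2-\tfrac1r y+S_0+O(\hbar)\Big).$$ For $S_0\in z\mathbb{C}[[z]]$ and $y=DS_0$, the equation $y-x^re^{ry}=0$ holds if and only if $x^r=ye^{-ry}$. The equation $\tfrac12y^2-\tfrac1ry+S_0=0$ holds if and only if $c\,x^r=ye^{-ry}$ for some constant $c\in\mathbb{C}$; and it holds with the coefficient of $z^r$ in $S_0$ equal to $\frac1r$ if and only if $x^r=ye^{-ry}$. For $\Psi=Z^{(r)}$ one has $S_0=F_{0,1}^{(r)}(z)$, a series without constant term whose coefficient of $z^r$ is $\frac1r$, and $y=DF_{0,1}^{(r)}=z^r$, which is the only $y\in z\mathbb{C}[[z]]$ with $x^r=ye^{-ry}$; thus the curve is $x=ze^{-z^r}$, $y=z^r$. -/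

import Mathlib

/-!
Labelling the poles and dividing by `n!` amounts to not labelling them, so the sum over `(g, n)` is
the generating function of connected monodromy data `(α, τ₁, …, τₛ)` weighted by
`x^d ħ^{s - d/r} / (d! s!)`; the Riemann-Hurwitz formula turns `s - d/r` into `2g - 2 + n`. By the
exponential formula its exponential counts all monodromy data, connected or not, and in degree
`d = rm` there are `(rm)! / (m! r^m) * binom(rm, 2)^s` of them. Hence
`Z = ∑ₘ x^{rm} ħ^{-m} e^{rm(rm-1)ħ/2} / (m! r^m)`.
Since `D = x ∂/∂x`, the operator `e^{rħD}` rescales `x` by `e^{rħ}`, and both equations as well as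
the commutator relation are identities between coefficients of powers of `x`.
-/

namespace OrbifoldHurwitz

noncomputable section

/-! ### Orbifold Hurwitz numbers -/

/-- Monodromy data of a connected branched covering of the sphere of degree `d`:
`α` is the monodromy around `0`, all of whose cycles have length `r`; the `τ i` are the
transpositions at the `s` simple branch points; `ℓ` labels the cycles of the monodromy at `∞`
(that is, the poles) by `Fin n`, the `i`-th cycle having length `μ i`.
The covering is connected: the monodromy group is transitive on the sheets. -/
structure IsMonodromy (r : ℕ) {n d s : ℕ} (μ : Fin n → ℕ)
    (α : Equiv.Perm (Fin d)) (τ : Fin s → Equiv.Perm (Fin d)) (ℓ : Fin d → Fin n) : Prop where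
  zeros : ∀ x, Function.minimalPeriod α x = r
  simple : ∀ i, (τ i).IsSwap
  poles : ∀ x y, ℓ x = ℓ y ↔ (α * (List.ofFn τ).prod).SameCycle x y
  orders : ∀ i, Nat.card {x // ℓ x = i} = μ i
  connected : MulAction.IsPretransitive
    (Subgroup.closure (insert α (Set.range τ))) (Fin d)

/-- The number of simple branch points given by the Riemann-Hurwitz formula,
`s = 2g - 2 + n + (μ₁ + ⋯ + μₙ) / r`. (It is nonnegative as soon as `n ≥ 1` and there is at
least one zero; when `r` does not divide `μ₁ + ⋯ + μₙ` there are no coverings at all.) -/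
def simpleBranchPoints (r g : ℕ) {n : ℕ} (μ : Fin n → ℕ) : ℕ :=
  2 * g + n + (∑ i, μ i) / r - 2

/-- The orbifold Hurwitz number `H_{g,n}^{(r)}(μ₁, …, μₙ)`: the number of connected genus `g`
coverings with `n` labelled poles of orders `μ`, all zeros of order `r` (unlabelled), and
otherwise simply ramified, each weighted by the inverse order of its automorphism group. Dividing
the number of monodromy data by `d!` gives the weighted count of isomorphism classes for ordered
simple branch points; the factor `1 / s!` is there because the simple branch points are
not labelled. -/
def hurwitz (r g : ℕ) {n : ℕ} (μ : Fin n → ℕ) : ℚ :=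
  (Nat.card {c : Equiv.Perm (Fin (∑ i, μ i)) ×
      (Fin (simpleBranchPoints r g μ) → Equiv.Perm (Fin (∑ i, μ i))) ×
      (Fin (∑ i, μ i) → Fin n) // IsMonodromy r μ c.1 c.2.1 c.2.2} : ℚ) /
    ((∑ i, μ i).factorial * (simpleBranchPoints r g μ).factorial)

/-! ### Free energies -/

/-- The composition `exp(f)` for a formal power series `f` without constant term. -/
def fexp {K : Type*} [CommRing K] [Algebra ℚ K] (f : PowerSeries K) : PowerSeries K :=
  PowerSeries.subst f (PowerSeries.exp K)

/-- The `r`-Lambert function `x = e^{-w} = z e^{-z^r}`, as a power series in `z`. -/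
def lambertX (r : ℕ) : PowerSeries ℂ :=
  PowerSeries.X * fexp (-(PowerSeries.X ^ r))

/-- The free energy `F_{g,n}[x₁, …, xₙ] = ∑_{μ ∈ ℤ₊ⁿ} H_{g,n}(μ) ∏ xᵢ^{μᵢ}`. -/
def freeEnergyX (r g n : ℕ) : MvPowerSeries (Fin n) ℂ :=
  fun μ => if ∀ i, 0 < μ i then (hurwitz r g μ : ℂ) else 0

/-- The free energy `F_{g,n}(z₁, …, zₙ)`, obtained by `xᵢ = zᵢ e^{-zᵢ^r}`. -/
def freeEnergy (r g n : ℕ) : MvPowerSeries (Fin n) ℂ :=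
  MvPowerSeries.subst
    (fun i => PowerSeries.subst (MvPowerSeries.X i : MvPowerSeries (Fin n) ℂ) (lambertX r))
    (freeEnergyX r g n)

/-- The principal specialization `F_{g,n}(z, …, z)`. -/
def freeEnergyDiag (r g n : ℕ) : PowerSeries ℂ :=
  MvPowerSeries.subst (fun _ : Fin n => (PowerSeries.X : PowerSeries ℂ)) (freeEnergy r g n)

/-- `S_m(z) = ∑ F_{g,n}(z, …, z) / n!` over all `g ≥ 0`, `n ≥ 1` with `2g - 2 + n = m - 1`:
the coefficient of `ħ^{m-1}` in `∑_{g ≥ 0, n ≥ 1} ħ^{2g-2+n} F_{g,n}(z, …, z) / n!`. -/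
def freeEnergyS (r m : ℕ) : PowerSeries ℂ :=
  ∑ p ∈ (Finset.range (m + 2) ×ˢ Finset.Icc 1 (m + 1)).filter (fun p => 2 * p.1 + p.2 = m + 1),
    ((p.2.factorial : ℂ)⁻¹) • freeEnergyDiag r p.1 p.2

/-! ### Formal series in `z` whose coefficients are Laurent series in `ħ` -/

/-- `ℂ((ħ))[[z]]`. -/
abbrev Fun : Type := PowerSeries (LaurentSeries ℂ)

/-- Power series in `z` as series in `z` and `ħ` that are constant in `ħ`. -/
def emb : PowerSeries ℂ →+* Fun := PowerSeries.map HahnSeries.C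

/-- `ħ`. -/
def hbar : LaurentSeries ℂ := HahnSeries.single 1 1

/-- `e^{cħ}`. -/
def expHbar (c : ℂ) : LaurentSeries ℂ :=
  HahnSeries.ofPowerSeries ℤ ℂ (PowerSeries.rescale c (PowerSeries.exp ℂ))

/-- `∑_{m ≥ 0} ħ^{m-1} S_m(z)`. -/
def phase (S : ℕ → PowerSeries ℂ) : Fun :=
  PowerSeries.mk fun d => HahnSeries.single (-1 : ℤ) (1 : ℂ) *
    HahnSeries.ofPowerSeries ℤ ℂ (PowerSeries.mk fun m => PowerSeries.coeff d (S m))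

/-- The partition function
`Z(z, ħ) = exp(∑_{g ≥ 0} ∑_{n ≥ 1} ħ^{2g-2+n} F_{g,n}(z, …, z) / n!)`. -/
def partitionFunction (r : ℕ) : Fun := fexp (phase (freeEnergyS r))

/-! ### Operators -/

/-- `D = z / (1 - r z^r) ∂/∂z`, on power series in `z` over a field `K`. -/
def opD (r : ℕ) (K : Type*) [Field K] : AddMonoid.End (PowerSeries K) :=
  (AddMonoidHom.mulLeft
      (PowerSeries.X * (1 - PowerSeries.C (r : K) * PowerSeries.X ^ r)⁻¹)).comp
    (PowerSeries.derivative K).toLinearMap.toAddMonoidHom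

/-- Multiplication by an element of `ℂ((ħ))[[z]]`. -/
def mulOp (a : Fun) : AddMonoid.End Fun := AddMonoidHom.mulLeft a

/-- `∂/∂ħ`. -/
def dHbar : AddMonoid.End Fun where
  toFun f := PowerSeries.mk fun d => LaurentSeries.derivative ℂ (PowerSeries.coeff d f)
  map_zero' := by ext1 d; simp
  map_add' f g := by ext1 d; simp

/-- The coefficients of `z^0, …, z^d` of `f` have no terms `ħ^j` with `j < N`. -/
def OrdGE (d : ℕ) (N : ℤ) (f : Fun) : Prop :=
  ∀ i ≤ d, ∀ j < N, (PowerSeries.coeff i f).coeff j = 0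

theorem exists_ordGE (d : ℕ) (f : Fun) : ∃ N, OrdGE d N f := by
  induction d with
  | zero =>
    refine ⟨(PowerSeries.coeff 0 f).order, fun i hi j hj => ?_⟩
    obtain rfl : i = 0 := by omega
    exact HahnSeries.coeff_eq_zero_of_lt_order hj
  | succ d ih =>
    obtain ⟨N, hN⟩ := ih
    refine ⟨min N (PowerSeries.coeff (d + 1) f).order, fun i hi j hj => ?_⟩
    rcases Nat.lt_or_ge d i with h | h
    · obtain rfl : i = d + 1 := by omega
      exact HahnSeries.coeff_eq_zero_of_lt_order (lt_of_lt_of_le hj (min_le_right _ _))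
    · exact hN i h j (lt_of_lt_of_le hj (min_le_left _ _))

theorem OrdGE.emb_mul {d : ℕ} {N : ℤ} {f : Fun} (h : OrdGE d N f) (u : PowerSeries ℂ) :
    OrdGE d N (emb u * f) := by
  intro i hi j hj
  rw [PowerSeries.coeff_mul, HahnSeries.coeff_sum]
  refine Finset.sum_eq_zero fun p hp => ?_
  rw [Finset.HasAntidiagonal.mem_antidiagonal] at hp
  rw [emb, PowerSeries.coeff_map, HahnSeries.C_mul_eq_smul, HahnSeries.coeff_smul,
    h p.2 (by omega) j hj, smul_zero]

theorem emb_inv (r : ℕ) :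
    emb (1 - PowerSeries.C (r : ℂ) * PowerSeries.X ^ r)⁻¹ =
      (1 - PowerSeries.C (r : LaurentSeries ℂ) * PowerSeries.X ^ r)⁻¹ := by
  have h0 (K : Type) [Field K] : PowerSeries.constantCoeff
      (1 - PowerSeries.C (r : K) * PowerSeries.X ^ r) ≠ 0 := by
    rcases Nat.eq_zero_or_pos r with rfl | h
    · simp
    · simp [h.ne']
  have he : emb (1 - PowerSeries.C (r : ℂ) * PowerSeries.X ^ r) =
      1 - PowerSeries.C (r : LaurentSeries ℂ) * PowerSeries.X ^ r := by
    simp [emb]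
  rw [PowerSeries.eq_inv_iff_mul_eq_one (h0 _), ← he, ← map_mul,
    PowerSeries.inv_mul_cancel _ (h0 _), map_one]

theorem opD_apply (r : ℕ) (f : Fun) : opD r (LaurentSeries ℂ) f =
    emb (1 - PowerSeries.C (r : ℂ) * PowerSeries.X ^ r)⁻¹ *
      (PowerSeries.X * PowerSeries.derivative (LaurentSeries ℂ) f) := by
  have h : opD r (LaurentSeries ℂ) f =
      (PowerSeries.X * (1 - PowerSeries.C (r : LaurentSeries ℂ) * PowerSeries.X ^ r)⁻¹) *
        PowerSeries.derivative (LaurentSeries ℂ) f := rfl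
  rw [h, emb_inv]
  ring

theorem OrdGE.opD_apply {r d : ℕ} {N : ℤ} {f : Fun} (h : OrdGE d N f) :
    OrdGE d N (opD r (LaurentSeries ℂ) f) := by
  rw [OrbifoldHurwitz.opD_apply]
  refine OrdGE.emb_mul (fun i hi j hj => ?_) _
  cases i with
  | zero => simp
  | succ i =>
    rw [PowerSeries.coeff_succ_X_mul, PowerSeries.coeff_derivative, mul_comm]
    have e : ((i : LaurentSeries ℂ) + 1) = HahnSeries.C ((i : ℂ) + 1) := by
      rw [map_add, map_one, map_natCast]
    rw [e, HahnSeries.C_mul_eq_smul, HahnSeries.coeff_smul, h (i + 1) hi j hj, smul_zero]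

theorem OrdGE.opD_iterate {r d : ℕ} {N : ℤ} {f : Fun} (h : OrdGE d N f) (k : ℕ) :
    OrdGE d N ((opD r (LaurentSeries ℂ))^[k] f) := by
  induction k with
  | zero => exact h
  | succ k ih => rw [Function.iterate_succ_apply']; exact OrdGE.opD_apply ih

/-- The coefficient of `z^d ħ^j` in the `k`-th term `(cħD)^k f / k!` of `e^{cħD} f`. -/
def expTerm (r : ℕ) (c : ℂ) (f : Fun) (d : ℕ) (j : ℤ) (k : ℕ) : ℂ :=
  c ^ k / k.factorial *
    (PowerSeries.coeff d ((opD r (LaurentSeries ℂ))^[k] f)).coeff (j - k)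

theorem expTerm_eq_zero {r : ℕ} {c : ℂ} {f : Fun} {d : ℕ} {N : ℤ} (h : OrdGE d N f)
    {j : ℤ} {k : ℕ} (hk : j - k < N) : expTerm r c f d j k = 0 := by
  rw [expTerm, h.opD_iterate k d le_rfl _ hk, mul_zero]

theorem expTerm_support_finite (r : ℕ) (c : ℂ) (f : Fun) (d : ℕ) (j : ℤ) :
    (Function.support (expTerm r c f d j)).Finite := by
  obtain ⟨N, hN⟩ := exists_ordGE d f
  refine (Set.finite_Iic (j - N).toNat).subset fun k hk => ?_
  by_contra hlt
  refine hk (expTerm_eq_zero hN ?_)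
  simp only [Set.mem_Iic, not_le] at hlt
  omega

theorem expTerm_bddBelow (r : ℕ) (c : ℂ) (f : Fun) (d : ℕ) :
    BddBelow (Function.support fun j => ∑ᶠ k, expTerm r c f d j k) := by
  obtain ⟨N, hN⟩ := exists_ordGE d f
  refine ⟨N, fun j hj => ?_⟩
  by_contra hlt
  refine hj ?_
  have : ∀ k, expTerm r c f d j k = 0 := fun k => expTerm_eq_zero hN (by omega)
  simp [this]

/-- The infinite order operator `e^{cħD} = ∑_k (cħD)^k / k!`. In the coefficient of each
`z^d ħ^j` only finitely many terms of the series are nonzero. -/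
def expOpD (r : ℕ) (c : ℂ) : AddMonoid.End Fun where
  toFun f := PowerSeries.mk fun d =>
    HahnSeries.ofSuppBddBelow (fun j => ∑ᶠ k, expTerm r c f d j k) (expTerm_bddBelow r c f d)
  map_zero' := by
    ext d j
    simp [expTerm]
  map_add' f g := by
    ext d j
    simp only [PowerSeries.coeff_mk, HahnSeries.coeff_ofSuppBddBelow, map_add,
      HahnSeries.coeff_add]
    rw [← finsum_add_distrib (expTerm_support_finite r c f d j)
      (expTerm_support_finite r c g d j)]
    refine finsum_congr fun k => ?_
    simp [expTerm, mul_add]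

/-- `P = ħD - e^{r(-w + (r-1)ħ/2)} e^{rħD}`, where `e^{-w} = x = z e^{-z^r}`. -/
def opP (r : ℕ) : AddMonoid.End Fun :=
  mulOp (PowerSeries.C hbar) * opD r (LaurentSeries ℂ) -
    mulOp (emb (lambertX r) ^ r * PowerSeries.C (expHbar ((r : ℂ) * ((r : ℂ) - 1) / 2))) *
      expOpD r (r : ℂ)

/-- `Q = (ħ/2) D² - (1/r + ħ/2) D - ħ ∂/∂ħ`. -/
def opQ (r : ℕ) : AddMonoid.End Fun :=
  mulOp (PowerSeries.C (HahnSeries.C (1 / 2 : ℂ) * hbar)) * opD r (LaurentSeries ℂ) ^ 2 -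
    mulOp (PowerSeries.C (HahnSeries.C (1 / (r : ℂ)) + HahnSeries.C (1 / 2 : ℂ) * hbar)) *
      opD r (LaurentSeries ℂ) -
    mulOp (PowerSeries.C hbar) * dHbar

/-! ### Semi-classical limit -/

/-- `G = ħ^k (L(z) + O(ħ))` as `ħ → 0`, coefficientwise in `z`. -/
def HasLeadingTerm (G : Fun) (k : ℤ) (L : PowerSeries ℂ) : Prop :=
  ∀ d, (∀ j < k, (PowerSeries.coeff d G).coeff j = 0) ∧
    (PowerSeries.coeff d G).coeff k = PowerSeries.coeff d L

/-- The semi-classical limit of the equation `T Ψ = 0`, of order `ħ^k`, is `L(S) = 0`: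
for every WKB wave function `Ψ = exp(∑_{m ≥ 0} ħ^{m-1} S_m(z))` one has
`Ψ⁻¹ T Ψ = ħ^k (L(S₀) + O(ħ))`. -/
def IsSemiclassicalLimit (T : AddMonoid.End Fun) (k : ℤ)
    (L : PowerSeries ℂ → PowerSeries ℂ) : Prop :=
  ∀ S : ℕ → PowerSeries ℂ, (∀ m, PowerSeries.constantCoeff (S m) = 0) →
    HasLeadingTerm (fexp (-phase S) * T (fexp (phase S))) k (L (S 0))

/-- The series `y(z)` parametrizes, together with `x = z e^{-z^r}`, the `r`-Lambert curve
`x^r = y e^{-ry}`. -/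
def OnLambertCurve (r : ℕ) (y : PowerSeries ℂ) : Prop :=
  lambertX r ^ r = y * fexp (-(PowerSeries.C (r : ℂ) * y))

end

end OrbifoldHurwitz

namespace OrbifoldHurwitz

noncomputable section

section FormalSeries

open PowerSeries

section Coefficients

variable {K : Type*} [CommRing K]

theorem coeff_X_mul_derivative (n : ℕ) (f : PowerSeries K) :
    coeff n (X * derivative K f) = n * coeff n f := by
  cases n with
  | zero => simp
  | succ n => rw [coeff_succ_X_mul, coeff_derivative, mul_comm, Nat.cast_succ]

theorem constantCoeff_map {K' : Type*} [CommRing K'] (φ : K →+* K') (f : PowerSeries K) :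
    constantCoeff (map φ f) = φ (constantCoeff f) := by
  simp only [← coeff_zero_eq_constantCoeff_apply, coeff_map]

theorem constantCoeff_rescale (a : K) (f : PowerSeries K) :
    constantCoeff (rescale a f) = constantCoeff f := by
  simp only [← coeff_zero_eq_constantCoeff_apply, coeff_rescale, pow_zero, one_mul]

theorem derivative_map {K' : Type*} [CommRing K'] (φ : K →+* K') (f : PowerSeries K) :
    derivative K' (map φ f) = map φ (derivative K f) := by
  ext n
  simp [coeff_derivative]

theorem derivative_rescale (a : K) (f : PowerSeries K) :
    derivative K (rescale a f) = C a * rescale a (derivative K f) := by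
  ext n
  simp only [coeff_derivative, coeff_rescale, coeff_C_mul]
  ring

theorem coeff_subst_eq_sum {a : PowerSeries K} (ha : constantCoeff a = 0) (f : PowerSeries K)
    (n : ℕ) : coeff n (f.subst a) = ∑ d ∈ Finset.range (n + 1), coeff d f * coeff n (a ^ d) := by
  rw [coeff_subst' (.of_constantCoeff_zero' ha)]
  refine finsum_eq_sum_of_support_subset _ fun d hd => ?_
  by_contra hnd
  have hlt : n < d := by simpa [Nat.lt_succ_iff] using hnd
  have hdvd : X ^ d ∣ a ^ d := pow_dvd_pow_of_dvd (X_dvd_iff.mpr ha) d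
  exact hd (by simp only [X_pow_dvd_iff.mp hdvd n hlt, smul_zero])

theorem constantCoeff_subst_of_constantCoeff_zero {a : PowerSeries K} (ha : constantCoeff a = 0)
    (f : PowerSeries K) : constantCoeff (f.subst a) = constantCoeff f := by
  simpa using coeff_subst_eq_sum ha f 0

theorem subst_C_mul {a : PowerSeries K} (ha : HasSubst a) (c : K) (f : PowerSeries K) :
    (C c * f).subst a = C c * f.subst a := by
  rw [subst_mul ha, show (C c).subst a = C c from subst_C c]

theorem subst_bijective {a : PowerSeries K} (h0 : constantCoeff a = 0) (h1 : IsUnit (coeff 1 a)) :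
    Function.Bijective fun f : PowerSeries K => f.subst a := by
  have ha : HasSubst a := .of_constantCoeff_zero' h0
  have hinv := HasSubst.substInvOfIsUnit a h1
  refine Function.bijective_iff_has_inverse.mpr
    ⟨fun f => PowerSeries.subst (a.substInvOfIsUnit h1) f, fun f => ?_, fun f => ?_⟩
  · simp only [subst_comp_subst_apply ha hinv, subst_substInvOfIsUnit_right a h0, X_subst]
  · simp only [subst_comp_subst_apply hinv ha, subst_substInvOfIsUnit_left a h0, X_subst]

theorem subst_left_injective {a y y' : PowerSeries K}
    (h0 : constantCoeff a = 0) (h1 : IsUnit (coeff 1 a)) (hy : constantCoeff y = 0)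
    (hy' : constantCoeff y' = 0) (h : a.subst y = a.subst y') : y = y' := by
  have hinv {u : PowerSeries K} (hu : constantCoeff u = 0) :
      (a.substInvOfIsUnit h1).subst (a.subst u) = u := by
    rw [← subst_comp_subst_apply (.of_constantCoeff_zero' h0) (.of_constantCoeff_zero' hu),
      subst_substInvOfIsUnit_left a h0, subst_X (.of_constantCoeff_zero' hu)]
  rw [← hinv hy, h, hinv hy']

theorem eq_of_derivative_eq_mul [IsAddTorsionFree K] {f g h : PowerSeries K}
    (hf : derivative K f = h * f) (hg : derivative K g = h * g)
    (h0 : constantCoeff f = constantCoeff g) : f = g := by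
  ext n
  induction n using Nat.strong_induction_on with
  | _ n ih =>
    cases n with
    | zero => simpa using h0
    | succ n =>
      have hcoeff : coeff n (derivative K f) = coeff n (derivative K g) := by
        rw [hf, hg, coeff_mul, coeff_mul]
        refine Finset.sum_congr rfl fun p hp => ?_
        rw [ih p.2 (by have := Finset.HasAntidiagonal.mem_antidiagonal.mp hp; omega)]
      rw [coeff_derivative, coeff_derivative] at hcoeff
      refine nsmul_right_injective n.succ_ne_zero ?_
      simpa only [nsmul_eq_mul, Nat.cast_succ, mul_comm] using hcoeff

theorem X_mul_derivative_eq_natCast_mul_iff [IsDomain K] [CharZero K] (r : ℕ)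
    (f : PowerSeries K) :
    X * derivative K f = C (r : K) * f ↔ ∃ c : K, C c * X ^ r = f := by
  constructor
  · refine fun h => ⟨coeff r f, ?_⟩
    ext d
    have hd : (d : K) * coeff d f = r * coeff d f := by
      rw [← coeff_X_mul_derivative, h, coeff_C_mul]
    rw [coeff_C_mul, coeff_X_pow]
    split_ifs with hdr
    · rw [hdr, mul_one]
    · rw [mul_zero]
      by_contra hne
      exact hdr (Nat.cast_injective (mul_right_cancel₀ (Ne.symm hne) hd))
  · rintro ⟨c, rfl⟩
    ext d
    rw [coeff_X_mul_derivative, coeff_C_mul, coeff_C_mul, coeff_X_pow]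
    split_ifs with hdr <;> simp [hdr]

end Coefficients

section FormalExp

variable {K : Type*} [CommRing K] [Algebra ℚ K] {f g : PowerSeries K}

theorem constantCoeff_fexp (hf : constantCoeff f = 0) : constantCoeff (fexp f) = 1 := by
  rw [fexp, constantCoeff_subst_of_constantCoeff_zero hf, constantCoeff_exp]

theorem derivative_fexp (hf : constantCoeff f = 0) :
    derivative K (fexp f) = derivative K f * fexp f := by
  rw [fexp, derivative_subst (.of_constantCoeff_zero' hf), derivative_exp, mul_comm]

theorem eq_fexp_of_derivative_eq_mul (hf : constantCoeff f = 0) (h0 : constantCoeff g = 1)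
    (hg : derivative K g = derivative K f * g) : g = fexp f := by
  have : IsAddTorsionFree K := .of_module_rat K
  exact eq_of_derivative_eq_mul hg (derivative_fexp hf) (h0.trans (constantCoeff_fexp hf).symm)

theorem fexp_zero : fexp (0 : PowerSeries K) = 1 :=
  (eq_fexp_of_derivative_eq_mul (map_zero _) (map_one _) (by simp)).symm

theorem fexp_add (hf : constantCoeff f = 0) (hg : constantCoeff g = 0) :
    fexp (f + g) = fexp f * fexp g := by
  refine (eq_fexp_of_derivative_eq_mul (by simp [hf, hg]) ?_ ?_).symm
  · rw [map_mul, constantCoeff_fexp hf, constantCoeff_fexp hg, one_mul]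
  · rw [Derivation.leibniz, derivative_fexp hf, derivative_fexp hg, smul_eq_mul, smul_eq_mul,
      map_add]
    ring

theorem fexp_neg_mul_fexp (hf : constantCoeff f = 0) : fexp (-f) * fexp f = 1 := by
  rw [← fexp_add (by simp [hf]) hf, neg_add_cancel, fexp_zero]

theorem isUnit_fexp (hf : constantCoeff f = 0) : IsUnit (fexp f) :=
  .of_mul_eq_one_right (fexp (-f)) (fexp_neg_mul_fexp hf)

theorem eq_mul_fexp_neg_iff (hf : constantCoeff f = 0) {u v : PowerSeries K} :
    u = v * fexp (-f) ↔ v = u * fexp f := by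
  have h := fexp_neg_mul_fexp hf
  exact ⟨fun e => by rw [e, mul_assoc, h, mul_one],
    fun e => by rw [e, mul_assoc, mul_comm (fexp f), h, mul_one]⟩

theorem fexp_pow (hf : constantCoeff f = 0) (n : ℕ) : fexp f ^ n = fexp (C (n : K) * f) := by
  induction n with
  | zero => simp [fexp_zero]
  | succ n ih =>
    rw [pow_succ, ih, ← fexp_add (by simp [hf]) hf, Nat.cast_succ, map_add, map_one, add_mul,
      one_mul]

theorem subst_fexp {a : PowerSeries K} (ha : constantCoeff a = 0) (hf : constantCoeff f = 0) :
    (fexp f).subst a = fexp (f.subst a) :=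
  subst_comp_subst_apply (.of_constantCoeff_zero' hf) (.of_constantCoeff_zero' ha) _

theorem map_fexp {K' : Type*} [CommRing K'] [Algebra ℚ K'] (φ : K →+* K')
    (hf : constantCoeff f = 0) : map φ (fexp f) = fexp (map φ f) := by
  have h := PowerSeries.map_subst (a := f) (.of_constantCoeff_zero' hf) (h := φ) (exp K)
  rwa [map_exp] at h

theorem rescale_fexp (a : K) (hf : constantCoeff f = 0) :
    rescale a (fexp f) = fexp (rescale a f) := by
  rw [rescale_eq_subst, rescale_eq_subst, subst_fexp (by simp) hf]

end FormalExp

section OpD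

variable {r : ℕ} {K : Type*} [Field K]

theorem opD_eq (f : PowerSeries K) : opD r K f =
    X * (1 - C (r : K) * X ^ r)⁻¹ * derivative K f := rfl

theorem one_sub_mul_inv_cancel (r : ℕ) (K : Type*) [Field K] :
    (1 - C (r : K) * X ^ r) * (1 - C (r : K) * X ^ r)⁻¹ = 1 :=
  PowerSeries.mul_inv_cancel _ <| by
    rcases Nat.eq_zero_or_pos r with rfl | h
    · simp
    · simp [h.ne']

theorem one_sub_mul_opD (f : PowerSeries K) :
    (1 - C (r : K) * X ^ r) * opD r K f = X * derivative K f := by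
  rw [opD_eq]
  linear_combination X * derivative K f * one_sub_mul_inv_cancel r K

theorem constantCoeff_opD (f : PowerSeries K) : constantCoeff (opD r K f) = 0 := by
  simp [opD_eq]

theorem coeff_self_opD (f : PowerSeries K) : coeff r (opD r K f) = r * coeff r f := by
  have h := congrArg (coeff r) (one_sub_mul_opD (r := r) f)
  rwa [coeff_X_mul_derivative, sub_mul, one_mul, map_sub, mul_assoc, coeff_C_mul,
    coeff_X_pow_mul', if_pos le_rfl, Nat.sub_self, coeff_zero_eq_constantCoeff_apply,
    constantCoeff_opD, mul_zero, sub_zero] at h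

theorem opD_mul (f g : PowerSeries K) : opD r K (f * g) = opD r K f * g + f * opD r K g := by
  simp only [opD_eq, Derivation.leibniz, smul_eq_mul]
  ring

theorem opD_C_mul (a : K) (f : PowerSeries K) : opD r K (C a * f) = C a * opD r K f := by
  rw [opD_mul, opD_eq, derivative_C, mul_zero, zero_mul, zero_add]

theorem opD_fexp [Algebra ℚ K] {f : PowerSeries K} (hf : constantCoeff f = 0) :
    opD r K (fexp f) = opD r K f * fexp f := by
  rw [opD_eq, opD_eq, derivative_fexp hf, mul_assoc _ (derivative K f)]

theorem eq_of_opD_eq [CharZero K] {f g : PowerSeries K} (h : opD r K f = opD r K g)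
    (h0 : constantCoeff f = constantCoeff g) : f = g := by
  have hX : X * derivative K f = X * derivative K g := by
    rw [← one_sub_mul_opD, h, one_sub_mul_opD]
  exact derivative.ext (X_mul_cancel hX) h0

theorem opD_subst {a : PowerSeries K} (h0 : constantCoeff a = 0)
    (ha : X * derivative K a = (1 - C (r : K) * X ^ r) * a) (f : PowerSeries K) :
    opD r K (f.subst a) = (X * derivative K f).subst a := by
  have hs : HasSubst a := .of_constantCoeff_zero' h0
  rw [opD_eq, derivative_subst hs, subst_mul hs, subst_X hs]
  linear_combination (1 - C (r : K) * X ^ r)⁻¹ * (derivative K f).subst a * ha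
    + (derivative K f).subst a * a * one_sub_mul_inv_cancel r K

end OpD

/-! ### The coordinate `x = z e^{-z^r}` -/

section Lambert

variable {r : ℕ}

theorem constantCoeff_lambertX (r : ℕ) : constantCoeff (lambertX r) = 0 := by
  simp [lambertX]

theorem constantCoeff_X_pow (hr : 0 < r) : constantCoeff (X ^ r : PowerSeries ℂ) = 0 := by
  simp [hr.ne']

theorem constantCoeff_neg_X_pow (hr : 0 < r) : constantCoeff (-(X ^ r) : PowerSeries ℂ) = 0 := by
  rw [map_neg, constantCoeff_X_pow hr, neg_zero]

theorem coeff_one_lambertX (hr : 0 < r) : coeff 1 (lambertX r) = 1 := by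
  rw [lambertX, show 1 = 0 + 1 from rfl, coeff_succ_X_mul, coeff_zero_eq_constantCoeff_apply,
    constantCoeff_fexp (constantCoeff_neg_X_pow hr)]

theorem lambertX_pow (hr : 0 < r) : lambertX r ^ r = X ^ r * fexp (-(C (r : ℂ) * X ^ r)) := by
  rw [lambertX, mul_pow, fexp_pow (constantCoeff_neg_X_pow hr), mul_neg]

theorem X_mul_derivative_lambertX (hr : 0 < r) :
    X * derivative ℂ (lambertX r) = (1 - C (r : ℂ) * X ^ r) * lambertX r := by
  have hX : X * derivative ℂ (X ^ r : PowerSeries ℂ) = C (r : ℂ) * X ^ r :=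
    (X_mul_derivative_eq_natCast_mul_iff r _).mpr ⟨1, by rw [map_one, one_mul]⟩
  rw [lambertX, Derivation.leibniz, derivative_fexp (constantCoeff_neg_X_pow hr), map_neg,
    derivative_X, smul_eq_mul, smul_eq_mul]
  linear_combination (-(X * fexp (-(X ^ r)))) * hX

theorem opD_subst_lambertX (hr : 0 < r) (f : PowerSeries ℂ) :
    opD r ℂ (f.subst (lambertX r)) = (X * derivative ℂ f).subst (lambertX r) :=
  opD_subst (constantCoeff_lambertX r) (X_mul_derivative_lambertX hr) f

theorem subst_lambertX_bijective (hr : 0 < r) :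
    Function.Bijective fun f : PowerSeries ℂ => f.subst (lambertX r) :=
  subst_bijective (constantCoeff_lambertX r) (coeff_one_lambertX hr ▸ isUnit_one)

theorem constantCoeff_emb (f : PowerSeries ℂ) :
    constantCoeff (emb f) = HahnSeries.C (constantCoeff f) :=
  constantCoeff_map _ f

theorem constantCoeff_emb_lambertX (r : ℕ) : constantCoeff (emb (lambertX r)) = 0 := by
  rw [constantCoeff_emb, constantCoeff_lambertX, map_zero]

theorem hasSubst_emb_lambertX (r : ℕ) : HasSubst (emb (lambertX r)) :=
  .of_constantCoeff_zero' (constantCoeff_emb_lambertX r)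

theorem opD_subst_emb_lambertX (hr : 0 < r) (f : Fun) :
    opD r (LaurentSeries ℂ) (f.subst (emb (lambertX r))) =
      (X * derivative (LaurentSeries ℂ) f).subst (emb (lambertX r)) := by
  refine opD_subst (constantCoeff_emb_lambertX r) ?_ f
  have h := congrArg emb (X_mul_derivative_lambertX hr)
  rw [emb, map_mul, ← derivative_map] at h
  simpa [emb] using h

theorem subst_emb_lambertX_surjective (hr : 0 < r) :
    Function.Surjective fun f : Fun => f.subst (emb (lambertX r)) := by
  refine (subst_bijective (constantCoeff_emb_lambertX r) ?_).surjective
  rw [emb, coeff_map, coeff_one_lambertX hr, map_one]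
  exact isUnit_one

end Lambert

/-! ### Laurent series in `ħ` -/

section Laurent

theorem ofPowerSeries_coeff_of_neg (p : PowerSeries ℂ) {n : ℤ} (hn : n < 0) :
    (HahnSeries.ofPowerSeries ℤ ℂ p).coeff n = 0 := by
  rw [coeff_coe, if_pos hn]

theorem laurent_coeff_C_mul (c : ℂ) (f : LaurentSeries ℂ) (n : ℤ) :
    (HahnSeries.C c * f).coeff n = c * f.coeff n := by
  rw [HahnSeries.C_mul_eq_smul, HahnSeries.coeff_smul, smul_eq_mul]

theorem laurent_coeff_natCast_mul (m : ℕ) (f : LaurentSeries ℂ) (n : ℤ) :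
    ((m : LaurentSeries ℂ) * f).coeff n = m * f.coeff n := by
  rw [← map_natCast (HahnSeries.C : ℂ →+* LaurentSeries ℂ), laurent_coeff_C_mul]

/-- The operator `ħ d/dħ` on `ℂ((ħ))`. -/
def eulerLaurent : LaurentSeries ℂ →+ LaurentSeries ℂ :=
  (AddMonoidHom.mulLeft hbar).comp (LaurentSeries.derivative ℂ).toAddMonoidHom

theorem eulerLaurent_apply (f : LaurentSeries ℂ) :
    eulerLaurent f = hbar * LaurentSeries.derivative ℂ f := rfl

theorem coeff_eulerLaurent (f : LaurentSeries ℂ) (n : ℤ) :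
    (eulerLaurent f).coeff n = n * f.coeff n := by
  rw [eulerLaurent_apply, hbar, HahnSeries.coeff_single_mul, LaurentSeries.derivative_apply,
    LaurentSeries.hasseDeriv_coeff]
  simp

theorem eulerLaurent_mul (f g : LaurentSeries ℂ) :
    eulerLaurent (f * g) = eulerLaurent f * g + f * eulerLaurent g := by
  have hsupp (u : LaurentSeries ℂ) : (eulerLaurent u).support ⊆ u.support := fun n hn h0 =>
    hn (by rw [coeff_eulerLaurent, h0, mul_zero])
  ext n
  rw [coeff_eulerLaurent, HahnSeries.coeff_add, HahnSeries.coeff_mul,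
    HahnSeries.coeff_mul_left' f.isPWO_support (hsupp f),
    HahnSeries.coeff_mul_right' g.isPWO_support (hsupp g), Finset.mul_sum,
    ← Finset.sum_add_distrib]
  refine Finset.sum_congr rfl fun p hp => ?_
  rw [coeff_eulerLaurent, coeff_eulerLaurent, ← (Finset.mem_antidiagonal.mp hp).2.2]
  push_cast
  ring

theorem eulerLaurent_C (c : ℂ) : eulerLaurent (HahnSeries.C c) = 0 := by
  ext n
  rw [coeff_eulerLaurent, HahnSeries.C_apply, HahnSeries.coeff_single, HahnSeries.coeff_zero]
  split_ifs with hn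
  · rw [hn, Int.cast_zero, zero_mul]
  · rw [mul_zero]

theorem eulerLaurent_natCast (m : ℕ) : eulerLaurent (m : LaurentSeries ℂ) = 0 := by
  rw [← map_natCast (HahnSeries.C : ℂ →+* LaurentSeries ℂ), eulerLaurent_C]

theorem eulerLaurent_ofPowerSeries (p : PowerSeries ℂ) :
    eulerLaurent (HahnSeries.ofPowerSeries ℤ ℂ p) =
      HahnSeries.ofPowerSeries ℤ ℂ (X * derivative ℂ p) := by
  ext n
  rw [coeff_eulerLaurent, coeff_coe, coeff_coe]
  split_ifs with hn
  · rw [mul_zero]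
  · rw [coeff_X_mul_derivative, Nat.cast_natAbs, abs_of_nonneg (not_lt.mp hn)]

theorem eulerLaurent_hbar : eulerLaurent hbar = hbar := by
  rw [hbar, ← HahnSeries.ofPowerSeries_X, eulerLaurent_ofPowerSeries, derivative_X, mul_one]

theorem eulerLaurent_expHbar (c : ℂ) :
    eulerLaurent (expHbar c) = HahnSeries.C c * hbar * expHbar c := by
  rw [expHbar, eulerLaurent_ofPowerSeries, derivative_rescale, derivative_exp, map_mul, map_mul,
    HahnSeries.ofPowerSeries_X, HahnSeries.ofPowerSeries_C, hbar]
  ring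

theorem expHbar_zero : expHbar 0 = 1 := by
  rw [expHbar, rescale_zero]
  simp

theorem expHbar_add (a b : ℂ) : expHbar (a + b) = expHbar a * expHbar b := by
  rw [expHbar, expHbar, expHbar, ← map_mul, exp_mul_exp_eq_exp_add]

theorem expHbar_pow (c : ℂ) (n : ℕ) : expHbar c ^ n = expHbar (n * c) := by
  induction n with
  | zero => simp [expHbar_zero]
  | succ n ih => rw [pow_succ, ih, ← expHbar_add, Nat.cast_succ, add_one_mul]

theorem laurent_coeff_mul (f g : LaurentSeries ℂ) (n : ℤ) :
    (f * g).coeff n = ∑ᶠ i : ℤ, f.coeff i * g.coeff (n - i) := by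
  classical
  set s := Finset.antidiagonal f.isPWO_support g.isPWO_support n
  have hsnd {p : ℤ × ℤ} (hp : p ∈ s) : p.2 = n - p.1 :=
    eq_sub_of_add_eq' (Finset.mem_antidiagonal.mp hp).2.2
  rw [HahnSeries.coeff_mul, finsum_eq_sum_of_support_subset (s := s.image Prod.fst),
    Finset.sum_image]
  · exact Finset.sum_congr rfl fun p hp => by rw [hsnd hp]
  · exact fun p hp q hq h => Prod.ext h (by rw [hsnd hp, hsnd hq, h])
  · refine fun i hi => Finset.mem_coe.mpr (Finset.mem_image.mpr ⟨(i, n - i), ?_, rfl⟩)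
    exact Finset.mem_antidiagonal.mpr
      ⟨left_ne_zero_of_mul hi, right_ne_zero_of_mul hi, add_sub_cancel i n⟩

theorem coeff_expHbar_mul (c : ℂ) (g : LaurentSeries ℂ) (n : ℤ) :
    (expHbar c * g).coeff n = ∑ᶠ k : ℕ, c ^ k / k.factorial * g.coeff (n - k) := by
  have hsupp : (Function.support fun i : ℤ => (expHbar c).coeff i * g.coeff (n - i)) ⊆
      Set.range ((↑) : ℕ → ℤ) := fun i hi =>
    CanLift.prf i (not_lt.mp fun hneg => left_ne_zero_of_mul hi (ofPowerSeries_coeff_of_neg _ hneg))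
  rw [laurent_coeff_mul, ← Set.indicator_eq_self.mpr hsupp, ← finsum_mem_def,
    finsum_mem_range Nat.cast_injective]
  refine finsum_congr fun k => ?_
  rw [expHbar, coeff_coe, if_neg (by omega), Int.natAbs_natCast, coeff_rescale, coeff_exp, map_div₀,
    map_one, map_natCast, mul_one_div]

theorem finite_support_mul_coeff_sub (c : ℕ → ℂ) (g : LaurentSeries ℂ) (n : ℤ) :
    (Function.support fun k : ℕ => c k * g.coeff (n - k)).Finite := by
  refine (Set.finite_Iic (n - g.order).toNat).subset fun k hk => ?_
  have := HahnSeries.order_le_of_coeff_ne_zero (right_ne_zero_of_mul hk)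
  rw [Set.mem_Iic]
  omega

end Laurent

section EulerHbar

theorem coeff_dHbar (d : ℕ) (f : Fun) :
    coeff d (dHbar f) = LaurentSeries.derivative ℂ (coeff d f) :=
  coeff_mk d fun d => LaurentSeries.derivative ℂ (coeff d f)

/-- The operator `ħ ∂/∂ħ` on `ℂ((ħ))[[z]]`. -/
def eulerHbar : AddMonoid.End Fun := mulOp (C hbar) * dHbar

theorem coeff_eulerHbar (d : ℕ) (f : Fun) : coeff d (eulerHbar f) = eulerLaurent (coeff d f) := by
  rw [eulerLaurent_apply, ← coeff_dHbar]
  exact coeff_C_mul d _ hbar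

theorem eulerHbar_mul (f g : Fun) : eulerHbar (f * g) = eulerHbar f * g + f * eulerHbar g := by
  ext1 d
  simp only [coeff_eulerHbar, coeff_mul, map_add, map_sum, eulerLaurent_mul,
    Finset.sum_add_distrib]

theorem eulerHbar_derivative (f : Fun) : eulerHbar (derivative (LaurentSeries ℂ) f) =
    derivative (LaurentSeries ℂ) (eulerHbar f) := by
  ext1 d
  rw [coeff_eulerHbar, coeff_derivative, coeff_derivative, coeff_eulerHbar, eulerLaurent_mul,
    ← Nat.cast_succ, eulerLaurent_natCast, mul_zero, add_zero]

theorem constantCoeff_eulerHbar (f : Fun) :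
    constantCoeff (eulerHbar f) = eulerLaurent (constantCoeff f) := by
  simp only [← coeff_zero_eq_constantCoeff_apply, coeff_eulerHbar]

theorem eulerHbar_fexp {f : Fun} (hf : constantCoeff f = 0) :
    eulerHbar (fexp f) = eulerHbar f * fexp f := by
  have : IsAddTorsionFree (LaurentSeries ℂ) := .of_module_rat _
  rw [← sub_eq_zero]
  refine eq_of_derivative_eq_mul (h := derivative _ f) ?_ (by simp) ?_
  · rw [map_sub, ← eulerHbar_derivative, derivative_fexp hf, eulerHbar_mul, Derivation.leibniz,
      derivative_fexp hf, eulerHbar_derivative, smul_eq_mul, smul_eq_mul]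
    ring
  · rw [map_sub, map_mul, constantCoeff_eulerHbar, constantCoeff_eulerHbar, constantCoeff_fexp hf,
      hf, map_zero, ← Nat.cast_one, eulerLaurent_natCast, zero_mul, sub_zero, map_zero]

theorem coeff_emb (d : ℕ) (f : PowerSeries ℂ) : coeff d (emb f) = HahnSeries.C (coeff d f) :=
  coeff_map _ d f

theorem coeff_subst_emb {a : PowerSeries ℂ} (ha : constantCoeff a = 0) (f : Fun) (d : ℕ) :
    coeff d (f.subst (emb a)) =
      ∑ i ∈ Finset.range (d + 1), HahnSeries.C (coeff d (a ^ i)) * coeff i f := by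
  rw [coeff_subst_eq_sum (by rw [constantCoeff_emb, ha, map_zero])]
  simp only [← map_pow, coeff_emb, mul_comm]

theorem eulerHbar_subst {a : PowerSeries ℂ} (ha : constantCoeff a = 0) (f : Fun) :
    eulerHbar (f.subst (emb a)) = (eulerHbar f).subst (emb a) := by
  ext1 d
  simp only [coeff_eulerHbar, coeff_subst_emb ha, map_sum, eulerLaurent_mul, eulerLaurent_C,
    zero_mul, zero_add]

end EulerHbar

/-! ### The operators in the variable `x` -/

/-- The operator `x ∂/∂x` on `ℂ((ħ))[[x]]`. -/
def eulerX (f : Fun) : Fun := X * derivative (LaurentSeries ℂ) f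

theorem coeff_eulerX (d : ℕ) (f : Fun) : coeff d (eulerX f) = d * coeff d f :=
  coeff_X_mul_derivative d f

theorem coeff_coeff_iterate_eulerX (k d : ℕ) (f : Fun) (j : ℤ) :
    (coeff d (eulerX^[k] f)).coeff j = d ^ k * (coeff d f).coeff j := by
  induction k with
  | zero => rw [Function.iterate_zero_apply, pow_zero, one_mul]
  | succ k ih =>
    rw [Function.iterate_succ_apply', coeff_eulerX, laurent_coeff_natCast_mul, ih, pow_succ',
      mul_assoc]

section XOperators

variable {r : ℕ}

theorem iterate_opD_subst (hr : 0 < r) (k : ℕ) (f : Fun) :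
    (opD r (LaurentSeries ℂ))^[k] (f.subst (emb (lambertX r))) =
      (eulerX^[k] f).subst (emb (lambertX r)) := by
  induction k with
  | zero => rfl
  | succ k ih =>
    rw [Function.iterate_succ_apply', Function.iterate_succ_apply', ih,
      opD_subst_emb_lambertX hr, eulerX]

theorem coeff_coeff_expOpD (c : ℂ) (f : Fun) (d : ℕ) (j : ℤ) :
    (coeff d (expOpD r c f)).coeff j = ∑ᶠ k, expTerm r c f d j k := by
  have h : coeff d (expOpD r c f) = HahnSeries.ofSuppBddBelow
      (fun j => ∑ᶠ k, expTerm r c f d j k) (expTerm_bddBelow r c f d) :=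
    coeff_mk d fun d => HahnSeries.ofSuppBddBelow
      (fun j => ∑ᶠ k, expTerm r c f d j k) (expTerm_bddBelow r c f d)
  rw [h, HahnSeries.coeff_ofSuppBddBelow]

theorem expTerm_subst (hr : 0 < r) (c : ℂ) (f : Fun) (d : ℕ) (j : ℤ) (k : ℕ) :
    expTerm r c (f.subst (emb (lambertX r))) d j k =
      ∑ i ∈ Finset.range (d + 1), coeff d (lambertX r ^ i) *
        ((i * c) ^ k / k.factorial * (coeff i f).coeff (j - k)) := by
  rw [expTerm, iterate_opD_subst hr, coeff_subst_emb (constantCoeff_lambertX r),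
    HahnSeries.coeff_sum, Finset.mul_sum]
  refine Finset.sum_congr rfl fun i _ => ?_
  rw [laurent_coeff_C_mul, coeff_coeff_iterate_eulerX, mul_pow]
  ring

theorem expOpD_subst (hr : 0 < r) (c : ℂ) (f : Fun) :
    expOpD r c (f.subst (emb (lambertX r))) =
      (rescale (expHbar c) f).subst (emb (lambertX r)) := by
  ext d j
  rw [coeff_coeff_expOpD, coeff_subst_emb (constantCoeff_lambertX r), HahnSeries.coeff_sum]
  simp_rw [expTerm_subst hr]
  rw [finsum_sum_comm _ _ fun i _ => (finite_support_mul_coeff_sub _ (coeff i f) j).subset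
    fun k hk => right_ne_zero_of_mul hk]
  refine Finset.sum_congr rfl fun i _ => ?_
  rw [coeff_rescale, expHbar_pow, laurent_coeff_C_mul, coeff_expHbar_mul, mul_finsum]

/-- The operator `P` in the variable `x`. -/
def opPX (r : ℕ) (f : Fun) : Fun :=
  C hbar * eulerX f -
    X ^ r * (C (expHbar ((r : ℂ) * ((r : ℂ) - 1) / 2)) * rescale (expHbar r) f)

/-- The operator `Q` in the variable `x`. -/
def opQX (r : ℕ) (f : Fun) : Fun :=
  C (HahnSeries.C (1 / 2 : ℂ) * hbar) * eulerX (eulerX f) -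
    C (HahnSeries.C (1 / (r : ℂ)) + HahnSeries.C (1 / 2 : ℂ) * hbar) * eulerX f - eulerHbar f

theorem opP_apply (f : Fun) : opP r f = C hbar * opD r (LaurentSeries ℂ) f -
    emb (lambertX r) ^ r * C (expHbar ((r : ℂ) * ((r : ℂ) - 1) / 2)) * expOpD r r f := rfl

theorem opQ_apply (f : Fun) : opQ r f =
    C (HahnSeries.C (1 / 2 : ℂ) * hbar) * opD r (LaurentSeries ℂ) (opD r (LaurentSeries ℂ) f) -
    C (HahnSeries.C (1 / (r : ℂ)) + HahnSeries.C (1 / 2 : ℂ) * hbar) *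
      opD r (LaurentSeries ℂ) f - eulerHbar f := rfl

theorem opP_subst (hr : 0 < r) (f : Fun) :
    opP r (f.subst (emb (lambertX r))) = (opPX r f).subst (emb (lambertX r)) := by
  have hs := hasSubst_emb_lambertX r
  rw [opP_apply, opPX, subst_sub hs, subst_C_mul hs, subst_mul hs, subst_C_mul hs,
    opD_subst_emb_lambertX hr, expOpD_subst hr, subst_pow hs, subst_X hs, mul_assoc, eulerX]

theorem opQ_subst (hr : 0 < r) (f : Fun) :
    opQ r (f.subst (emb (lambertX r))) = (opQX r f).subst (emb (lambertX r)) := by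
  have hs := hasSubst_emb_lambertX r
  rw [opQ_apply, opQX, subst_sub hs, subst_sub hs, subst_C_mul hs, subst_C_mul hs,
    opD_subst_emb_lambertX hr, opD_subst_emb_lambertX hr,
    eulerHbar_subst (constantCoeff_lambertX r), eulerX, eulerX]

theorem coeff_opPX (d : ℕ) (f : Fun) : coeff d (opPX r f) = hbar * (d * coeff d f) -
    if r ≤ d then expHbar ((r : ℂ) * ((r : ℂ) - 1) / 2 + (d - r : ℕ) * r) * coeff (d - r) f
    else 0 := by
  rw [opPX, map_sub, coeff_C_mul, coeff_eulerX, coeff_X_pow_mul', coeff_C_mul, coeff_rescale,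
    expHbar_pow, expHbar_add, mul_assoc]

theorem coeff_opQX (d : ℕ) (f : Fun) : coeff d (opQX r f) =
    (HahnSeries.C ((d : ℂ) * ((d : ℂ) - 1) / 2) * hbar - HahnSeries.C ((d : ℂ) / (r : ℂ))) *
      coeff d f - eulerLaurent (coeff d f) := by
  rw [opQX, map_sub, map_sub, coeff_C_mul, coeff_C_mul, coeff_eulerX, coeff_eulerX,
    coeff_eulerHbar, show (d : ℂ) * (d - 1) / 2 = 1 / 2 * d * (d - 1) by ring,
    div_eq_mul_one_div (d : ℂ)]
  simp only [map_mul, map_sub, map_one, map_natCast]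
  ring

theorem opPX_opQX_sub (hr : 0 < r) (f : Fun) :
    opPX r (opQX r f) - opQX r (opPX r f) = opPX r f := by
  ext1 d
  simp only [map_sub, coeff_opPX, coeff_opQX]
  split_ifs with h
  · obtain ⟨m, rfl⟩ := Nat.exists_eq_add_of_le' h
    have hr' : (r : ℂ) ≠ 0 := Nat.cast_ne_zero.mpr hr.ne'
    have hquad : ((m + r : ℕ) : ℂ) * ((m + r : ℕ) - 1) / 2 =
        m * (m - 1) / 2 + (r * (r - 1) / 2 + m * r) := by
      push_cast
      ring
    have hlin : ((m + r : ℕ) : ℂ) / r = m / r + 1 := by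
      rw [Nat.cast_add, add_div, div_self hr']
    rw [Nat.add_sub_cancel, hquad, hlin, map_add HahnSeries.C (_ / 2), map_add _ (_ / (r : ℂ)),
      map_one]
    simp only [eulerLaurent_mul, eulerLaurent_hbar, eulerLaurent_natCast, eulerLaurent_expHbar]
    ring
  · simp only [eulerLaurent_mul, eulerLaurent_hbar, eulerLaurent_natCast, map_zero]
    ring

theorem commutator (hr : 0 < r) : opP r * opQ r - opQ r * opP r = opP r := by
  ext1 f
  obtain ⟨g, rfl⟩ := subst_emb_lambertX_surjective hr f
  have hcomm (S T : AddMonoid.End Fun) (h : Fun) : (S * T - T * S) h = S (T h) - T (S h) := rfl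
  rw [hcomm, opQ_subst hr, opP_subst hr, opP_subst hr, opQ_subst hr,
    ← subst_sub (hasSubst_emb_lambertX r), opPX_opQX_sub hr]

end XOperators

/-! ### Leading terms in `ħ` -/

/-- Series in `z` over `ℂ[[ħ]]` as series over `ℂ((ħ))`. -/
def embPS : PowerSeries (PowerSeries ℂ) →+* Fun := PowerSeries.map (HahnSeries.ofPowerSeries ℤ ℂ)

/-- The value at `ħ = 0`. -/
def evalZero : PowerSeries (PowerSeries ℂ) →+* PowerSeries ℂ := PowerSeries.map constantCoeff

theorem coeff_embPS (d : ℕ) (G : PowerSeries (PowerSeries ℂ)) :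
    coeff d (embPS G) = HahnSeries.ofPowerSeries ℤ ℂ (coeff d G) :=
  coeff_map _ d G

theorem hasLeadingTerm_single_mul_embPS (k : ℤ) (G : PowerSeries (PowerSeries ℂ)) :
    HasLeadingTerm (C (HahnSeries.single k (1 : ℂ)) * embPS G) k (evalZero G) := fun d => by
  simp only [coeff_C_mul, coeff_embPS, HahnSeries.coeff_single_mul, one_mul, evalZero, coeff_map]
  refine ⟨fun j hj => ofPowerSeries_coeff_of_neg _ (by omega), ?_⟩
  rw [sub_self, coeff_coe, if_neg (lt_irrefl 0), Int.natAbs_zero,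
    coeff_zero_eq_constantCoeff_apply]

theorem HasLeadingTerm.exists_eq_single_mul_embPS {G : Fun} {k : ℤ} {L : PowerSeries ℂ}
    (h : HasLeadingTerm G k L) :
    ∃ G₀, G = C (HahnSeries.single k (1 : ℂ)) * embPS G₀ ∧ evalZero G₀ = L := by
  refine ⟨.mk fun d => .mk fun n => (coeff d G).coeff (k + n), ?_, ?_⟩
  · ext d j
    rw [coeff_C_mul, HahnSeries.coeff_single_mul, one_mul, coeff_embPS, coeff_mk, coeff_coe,
      coeff_mk]
    split_ifs with hj
    · exact (h d).1 j (by omega)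
    · congr 1
      omega
  · ext d
    rw [evalZero, coeff_map, coeff_mk, ← coeff_zero_eq_constantCoeff_apply, coeff_mk, ← (h d).2,
      Nat.cast_zero, add_zero]

namespace HasLeadingTerm

variable {G G' : Fun} {k k' : ℤ} {L L' : PowerSeries ℂ}

protected theorem add (h : HasLeadingTerm G k L) (h' : HasLeadingTerm G' k L') :
    HasLeadingTerm (G + G') k (L + L') := fun d =>
  ⟨fun j hj => by rw [map_add, HahnSeries.coeff_add, (h d).1 j hj, (h' d).1 j hj, add_zero],
    by rw [map_add, HahnSeries.coeff_add, (h d).2, (h' d).2, map_add]⟩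

protected theorem neg (h : HasLeadingTerm G k L) : HasLeadingTerm (-G) k (-L) := fun d =>
  ⟨fun j hj => by rw [map_neg, HahnSeries.coeff_neg, (h d).1 j hj, neg_zero],
    by rw [map_neg, HahnSeries.coeff_neg, (h d).2, map_neg]⟩

protected theorem sub (h : HasLeadingTerm G k L) (h' : HasLeadingTerm G' k L') :
    HasLeadingTerm (G - G') k (L - L') := by
  rw [sub_eq_add_neg, sub_eq_add_neg]
  exact h.add h'.neg

protected theorem of_lt (h : HasLeadingTerm G k L) (hk : k' < k) : HasLeadingTerm G k' 0 :=
  fun d => ⟨fun j hj => (h d).1 j (hj.trans hk), by rw [(h d).1 k' hk, map_zero]⟩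

protected theorem mul (h : HasLeadingTerm G k L) (h' : HasLeadingTerm G' k' L') :
    HasLeadingTerm (G * G') (k + k') (L * L') := by
  obtain ⟨A, rfl, rfl⟩ := h.exists_eq_single_mul_embPS
  obtain ⟨B, rfl, rfl⟩ := h'.exists_eq_single_mul_embPS
  have hsingle : (HahnSeries.single (k + k') (1 : ℂ) : LaurentSeries ℂ) =
      HahnSeries.single k 1 * HahnSeries.single k' 1 := by
    rw [HahnSeries.single_mul_single, one_mul]
  rw [mul_mul_mul_comm, ← map_mul C, ← hsingle, ← map_mul, ← map_mul]
  exact hasLeadingTerm_single_mul_embPS _ _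

protected theorem embPS (G : PowerSeries (PowerSeries ℂ)) :
    HasLeadingTerm (embPS G) 0 (evalZero G) := by
  have h := hasLeadingTerm_single_mul_embPS 0 G
  rwa [show (HahnSeries.single 0 (1 : ℂ) : LaurentSeries ℂ) = 1 from rfl, map_one, one_mul] at h

protected theorem emb (u : PowerSeries ℂ) : HasLeadingTerm (emb u) 0 u := fun d => by
  rw [coeff_emb, HahnSeries.C_apply]
  exact ⟨fun j hj => HahnSeries.coeff_single_of_ne hj.ne, HahnSeries.coeff_single_same _ _⟩

protected theorem C_hbar : HasLeadingTerm (C hbar) 1 1 := by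
  have h := hasLeadingTerm_single_mul_embPS 1 1
  rwa [map_one embPS, map_one evalZero, mul_one] at h

protected theorem C_C (c : ℂ) : HasLeadingTerm (C (HahnSeries.C c)) 0 (C c) := by
  have h := HasLeadingTerm.emb (C c)
  rwa [emb, map_C] at h

protected theorem C_expHbar (c : ℂ) : HasLeadingTerm (C (expHbar c)) 0 1 := by
  have h := HasLeadingTerm.embPS (C (rescale c (exp ℂ)))
  rwa [embPS, map_C, evalZero, map_C, constantCoeff_rescale, constantCoeff_exp, map_one] at h

protected theorem fexp (h : HasLeadingTerm G 0 L) (h0 : constantCoeff G = 0) :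
    HasLeadingTerm (fexp G) 0 (fexp L) := by
  obtain ⟨A, rfl, rfl⟩ := h.exists_eq_single_mul_embPS
  rw [show (HahnSeries.single 0 (1 : ℂ) : LaurentSeries ℂ) = 1 from rfl, map_one, one_mul] at *
  have hA : constantCoeff A = 0 := HahnSeries.ofPowerSeries_injective (Γ := ℤ)
    (by rw [← constantCoeff_map]; exact h0.trans (map_zero _).symm)
  rw [embPS, ← map_fexp _ hA, evalZero, ← map_fexp _ hA]
  exact HasLeadingTerm.embPS _

protected theorem derivative (h : HasLeadingTerm G k L) :
    HasLeadingTerm (derivative (LaurentSeries ℂ) G) k (derivative ℂ L) := fun d => by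
  simp only [coeff_derivative, ← Nat.cast_succ, mul_comm _ (Nat.cast _), laurent_coeff_natCast_mul]
  exact ⟨fun j hj => by rw [(h _).1 j hj, mul_zero], by rw [(h _).2]⟩

protected theorem opD {r : ℕ} (h : HasLeadingTerm G k L) :
    HasLeadingTerm (opD r (LaurentSeries ℂ) G) k (opD r ℂ L) := by
  have hmul := (HasLeadingTerm.emb (X * (1 - C (r : ℂ) * X ^ r)⁻¹)).mul h.derivative
  rwa [zero_add, map_mul, emb_inv, show emb X = X from map_X _] at hmul

protected theorem eulerHbar (h : HasLeadingTerm G k L) :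
    HasLeadingTerm (eulerHbar G) k (C (k : ℂ) * L) := fun d => by
  rw [coeff_eulerHbar]
  refine ⟨fun j hj => ?_, ?_⟩
  · rw [coeff_eulerLaurent, (h d).1 j hj, mul_zero]
  · rw [coeff_eulerLaurent, (h d).2, coeff_C_mul]

protected theorem expOpD_sub {r : ℕ} (h : HasLeadingTerm G (-1) L) (c : ℂ) :
    HasLeadingTerm (expOpD r c G - G) 0 (C c * opD r ℂ L) := fun d => by
  have hord : OrdGE d (-1) G := fun i _ => (h i).1
  have hzeroth : ∀ j, expTerm r c G d j 0 = (coeff d G).coeff j := fun j => by simp [expTerm]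
  have hfirst : expTerm r c G d 0 1 = coeff d (C c * opD r ℂ L) := by
    rw [expTerm, Function.iterate_one, Nat.cast_one, zero_sub, (h.opD d).2, coeff_C_mul, pow_one,
      Nat.factorial_one, Nat.cast_one, div_one]
  simp only [map_sub, HahnSeries.coeff_sub, coeff_coeff_expOpD]
  refine ⟨fun j hj => ?_, ?_⟩
  · rw [finsum_eq_single _ 0 fun k hk => expTerm_eq_zero hord (by omega), hzeroth, sub_self]
  · rw [finsum_eq_sum_of_support_subset (s := Finset.range 2), Finset.sum_range_succ,
      Finset.sum_range_one, hzeroth, hfirst, add_sub_cancel_left]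
    intro k hk
    by_contra hk2
    rw [Finset.coe_range, Set.mem_Iio] at hk2
    exact hk (expTerm_eq_zero hord (by omega))

end HasLeadingTerm

theorem hasLeadingTerm_phase (S : ℕ → PowerSeries ℂ) : HasLeadingTerm (phase S) (-1) (S 0) := by
  let G : PowerSeries (PowerSeries ℂ) := .mk fun d => .mk fun m => coeff d (S m)
  have hG : C (HahnSeries.single (-1) 1) * embPS G = phase S := by
    ext1 d
    rw [coeff_C_mul, coeff_embPS, coeff_mk, phase, coeff_mk]
  have hG0 : evalZero G = S 0 := by
    ext d
    rw [evalZero, coeff_map, coeff_mk, ← coeff_zero_eq_constantCoeff_apply, coeff_mk]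
  exact hG ▸ hG0 ▸ hasLeadingTerm_single_mul_embPS (-1) G

theorem constantCoeff_phase {S : ℕ → PowerSeries ℂ} (hS : ∀ m, constantCoeff (S m) = 0) :
    constantCoeff (phase S) = 0 := by
  rw [← coeff_zero_eq_constantCoeff_apply, phase, coeff_mk]
  have : (PowerSeries.mk fun m => coeff 0 (S m)) = 0 := by
    ext m
    rw [coeff_mk, coeff_zero_eq_constantCoeff_apply, hS, map_zero]
  rw [this, map_zero, mul_zero]

section Semiclassical

variable {r : ℕ}

theorem constantCoeff_expOpD (hr : 0 < r) (c : ℂ) {f : Fun} (hf : constantCoeff f = 0) :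
    constantCoeff (expOpD r c f) = 0 := by
  have h0 := constantCoeff_emb_lambertX r
  obtain ⟨g, rfl⟩ := subst_emb_lambertX_surjective hr f
  rw [constantCoeff_subst_of_constantCoeff_zero h0] at hf
  rw [expOpD_subst hr, constantCoeff_subst_of_constantCoeff_zero h0, constantCoeff_rescale, hf]

theorem expOpD_fexp (hr : 0 < r) (c : ℂ) {f : Fun} (hf : constantCoeff f = 0) :
    expOpD r c (fexp f) = fexp (expOpD r c f) := by
  have h0 := constantCoeff_emb_lambertX r
  obtain ⟨g, rfl⟩ := subst_emb_lambertX_surjective hr f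
  rw [constantCoeff_subst_of_constantCoeff_zero h0] at hf
  have hg : constantCoeff (rescale (expHbar c) g) = 0 := by rw [constantCoeff_rescale, hf]
  rw [← subst_fexp h0 hf, expOpD_subst hr, rescale_fexp _ hf, subst_fexp h0 hg, expOpD_subst hr]

theorem fexp_neg_mul_opP_fexp (hr : 0 < r) {φ : Fun} (hφ : constantCoeff φ = 0) :
    fexp (-φ) * opP r (fexp φ) = C hbar * opD r (LaurentSeries ℂ) φ -
      emb (lambertX r ^ r) * C (expHbar ((r : ℂ) * ((r : ℂ) - 1) / 2)) *
        fexp (expOpD r r φ - φ) := by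
  have hinv := fexp_neg_mul_fexp hφ
  have hexp : fexp (expOpD r r φ - φ) = fexp (expOpD r r φ) * fexp (-φ) := by
    rw [sub_eq_add_neg, fexp_add (constantCoeff_expOpD hr _ hφ) (by rw [map_neg, hφ, neg_zero])]
  rw [opP_apply, opD_fexp hφ, expOpD_fexp hr _ hφ, hexp, map_pow]
  linear_combination C hbar * opD r (LaurentSeries ℂ) φ * hinv

theorem fexp_neg_mul_opQ_fexp {φ : Fun} (hφ : constantCoeff φ = 0) :
    fexp (-φ) * opQ r (fexp φ) =
      C (HahnSeries.C (1 / 2 : ℂ)) * C hbar *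
        (opD r (LaurentSeries ℂ) φ * opD r (LaurentSeries ℂ) φ +
          opD r (LaurentSeries ℂ) (opD r (LaurentSeries ℂ) φ)) -
      (C (HahnSeries.C (1 / (r : ℂ))) * opD r (LaurentSeries ℂ) φ +
        C (HahnSeries.C (1 / 2 : ℂ)) * C hbar * opD r (LaurentSeries ℂ) φ) - eulerHbar φ := by
  have hinv := fexp_neg_mul_fexp hφ
  rw [opQ_apply, opD_fexp hφ, opD_mul, opD_fexp hφ, eulerHbar_fexp hφ, map_mul, map_add, map_mul]
  set a := opD r (LaurentSeries ℂ) φ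
  linear_combination (C (HahnSeries.C (1 / 2 : ℂ)) * C hbar * (a * a + opD r (LaurentSeries ℂ) a) -
    (C (HahnSeries.C (1 / (r : ℂ))) * a + C (HahnSeries.C (1 / 2 : ℂ)) * C hbar * a) -
    eulerHbar φ) * hinv

theorem semiclassicalLimit_opP (hr : 0 < r) : IsSemiclassicalLimit (opP r) 0 (fun S =>
    opD r ℂ S - lambertX r ^ r * fexp (C (r : ℂ) * opD r ℂ S)) := by
  intro S hS
  have h0 := constantCoeff_phase hS
  have hphase := hasLeadingTerm_phase S
  have hD := HasLeadingTerm.C_hbar.mul (hphase.opD (r := r))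
  have hexp := (hphase.expOpD_sub (r := r) r).fexp
    (by rw [map_sub, constantCoeff_expOpD hr _ h0, h0, sub_zero])
  have hcoeff := (HasLeadingTerm.emb (lambertX r ^ r)).mul
    (HasLeadingTerm.C_expHbar ((r : ℂ) * ((r : ℂ) - 1) / 2))
  rw [fexp_neg_mul_opP_fexp hr h0]
  simpa only [one_mul, mul_one, add_neg_cancel] using hD.sub (hcoeff.mul hexp)

theorem semiclassicalLimit_opQ (r : ℕ) : IsSemiclassicalLimit (opQ r) (-1) (fun S =>
    (1 / 2 : ℂ) • opD r ℂ S ^ 2 - (1 / (r : ℂ)) • opD r ℂ S + S) := by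
  intro S hS
  have hphase := hasLeadingTerm_phase S
  have hD := hphase.opD (r := r)
  have hhalf := (HasLeadingTerm.C_C (1 / 2)).mul HasLeadingTerm.C_hbar
  have hquad := hhalf.mul ((hD.mul hD).add ((hD.opD (r := r)).of_lt (k' := -1 + -1) (by norm_num)))
  have hlin := ((HasLeadingTerm.C_C (1 / (r : ℂ))).mul hD).add
    ((hhalf.mul hD).of_lt (k' := 0 + -1) (by norm_num))
  rw [fexp_neg_mul_opQ_fexp (constantCoeff_phase hS)]
  convert (hquad.sub hlin).sub hphase.eulerHbar using 1
  · norm_num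
  · simp only [smul_eq_C_mul, Int.cast_neg, Int.cast_one, map_neg, map_one]
    ring

end Semiclassical

/-! ### The Lambert curve -/

section Curve

variable {r : ℕ}

theorem onLambertCurve_iff_sub_eq_zero {y : PowerSeries ℂ} (hy : constantCoeff y = 0) :
    OnLambertCurve r y ↔ y - lambertX r ^ r * fexp (C (r : ℂ) * y) = 0 := by
  rw [sub_eq_zero, OnLambertCurve, eq_mul_fexp_neg_iff (by rw [map_mul, hy, mul_zero])]

theorem opD_eq_mul_iff (hr : 0 < r) (u : PowerSeries ℂ) :
    opD r ℂ u = C (r : ℂ) * u ↔ ∃ c : ℂ, c • lambertX r ^ r = u := by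
  have hx : HasSubst (lambertX r) := .of_constantCoeff_zero' (constantCoeff_lambertX r)
  have hinj := (subst_lambertX_bijective hr).injective
  obtain ⟨g, rfl⟩ := (subst_lambertX_bijective hr).surjective u
  have hpow (c : ℂ) : c • lambertX r ^ r = (C c * X ^ r).subst (lambertX r) := by
    rw [subst_C_mul hx, subst_pow hx, subst_X hx, smul_eq_C_mul]
  simp only [opD_subst_lambertX hr, hpow, ← subst_C_mul hx, hinj.eq_iff]
  exact X_mul_derivative_eq_natCast_mul_iff r g

theorem opD_mul_fexp {y : PowerSeries ℂ} (hy : constantCoeff y = 0) :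
    opD r ℂ (y * fexp (-(C (r : ℂ) * y))) =
      opD r ℂ y * (1 - C (r : ℂ) * y) * fexp (-(C (r : ℂ) * y)) := by
  rw [opD_mul, opD_fexp (by simp [hy]), map_neg, opD_C_mul]
  ring

theorem opD_half_sq_sub (r : ℕ) (S : PowerSeries ℂ) :
    opD r ℂ ((1 / 2 : ℂ) • opD r ℂ S ^ 2 - (1 / (r : ℂ)) • opD r ℂ S + S) =
      opD r ℂ S * opD r ℂ (opD r ℂ S) - C (1 / (r : ℂ)) * opD r ℂ (opD r ℂ S) +
        opD r ℂ S := by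
  have htwo : C (1 / 2 : ℂ) * 2 = 1 := by
    rw [show (2 : PowerSeries ℂ) = C 2 from (map_ofNat _ 2).symm, ← map_mul]
    norm_num
  rw [map_add, map_sub, smul_eq_C_mul, smul_eq_C_mul, opD_C_mul, opD_C_mul, sq, opD_mul]
  linear_combination opD r ℂ S * opD r ℂ (opD r ℂ S) * htwo

/-- Applying `D` turns the left-hand equation into `D (y e^{-ry}) = r y e^{-ry}`. -/
theorem half_sq_sub_eq_zero_iff (hr : 0 < r) {S : PowerSeries ℂ} (hS : constantCoeff S = 0) :
    (1 / 2 : ℂ) • opD r ℂ S ^ 2 - (1 / (r : ℂ)) • opD r ℂ S + S = 0 ↔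
      ∃ c : ℂ, c • lambertX r ^ r = opD r ℂ S * fexp (-(C (r : ℂ) * opD r ℂ S)) := by
  have hy : constantCoeff (opD r ℂ S) = 0 := constantCoeff_opD S
  have hu : IsUnit (fexp (-(C (r : ℂ) * opD r ℂ S))) := isUnit_fexp (by simp [hy])
  have hinv : C (1 / (r : ℂ)) * C (r : ℂ) = 1 := by
    rw [← map_mul, one_div_mul_cancel (Nat.cast_ne_zero.mpr hr.ne'), map_one]
  have hD : (1 / 2 : ℂ) • opD r ℂ S ^ 2 - (1 / (r : ℂ)) • opD r ℂ S + S = 0 ↔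
      opD r ℂ ((1 / 2 : ℂ) • opD r ℂ S ^ 2 - (1 / (r : ℂ)) • opD r ℂ S + S) = 0 :=
    ⟨fun h => by rw [h, map_zero],
      fun h => eq_of_opD_eq (r := r) (by rw [h, map_zero]) (by simp [hS, hy])⟩
  rw [hD, opD_half_sq_sub, ← opD_eq_mul_iff hr, opD_mul_fexp hy, ← mul_assoc, hu.mul_left_inj]
  set y := opD r ℂ S
  constructor <;> intro h
  · linear_combination (-C (r : ℂ)) * h - opD r ℂ y * hinv
  · linear_combination (-C (1 / (r : ℂ))) * h + (-y - y * opD r ℂ y) * hinv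

theorem coeff_eq_of_smul_lambertX_pow (hr : 0 < r) {y : PowerSeries ℂ}
    (hy : constantCoeff y = 0) {c : ℂ}
    (h : c • lambertX r ^ r = y * fexp (-(C (r : ℂ) * y))) : coeff r y = c := by
  have hry : constantCoeff (C (r : ℂ) * y) = 0 := by rw [map_mul, hy, mul_zero]
  have hX : constantCoeff (-(C (r : ℂ) * X ^ r)) = 0 := by simp [hr.ne']
  rw [(eq_mul_fexp_neg_iff hry).mp h, smul_eq_C_mul, mul_assoc, coeff_C_mul, lambertX_pow hr,
    mul_assoc, coeff_X_pow_mul', if_pos le_rfl, Nat.sub_self, coeff_zero_eq_constantCoeff_apply,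
    map_mul, constantCoeff_fexp hX, constantCoeff_fexp hry, mul_one, mul_one]

theorem half_sq_sub_eq_zero_and_coeff_iff (hr : 0 < r) {S : PowerSeries ℂ}
    (hS : constantCoeff S = 0) :
    (1 / 2 : ℂ) • opD r ℂ S ^ 2 - (1 / (r : ℂ)) • opD r ℂ S + S = 0 ∧
      coeff r S = 1 / (r : ℂ) ↔ OnLambertCurve r (opD r ℂ S) := by
  have hcoeff : coeff r S = 1 / (r : ℂ) ↔ coeff r (opD r ℂ S) = 1 := by
    rw [coeff_self_opD, eq_div_iff (Nat.cast_ne_zero.mpr hr.ne'), mul_comm]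
  rw [half_sq_sub_eq_zero_iff hr hS, hcoeff, OnLambertCurve]
  constructor
  · rintro ⟨⟨c, hc⟩, h⟩
    rw [← hc, ← coeff_eq_of_smul_lambertX_pow hr (constantCoeff_opD S) hc, h, one_smul]
  · intro h
    rw [← one_smul ℂ (lambertX r ^ r)] at h
    exact ⟨⟨1, h⟩, coeff_eq_of_smul_lambertX_pow hr (constantCoeff_opD S) h⟩

theorem onLambertCurve_iff (hr : 0 < r) (y : PowerSeries ℂ) :
    OnLambertCurve r y ∧ constantCoeff y = 0 ↔ y = X ^ r := by
  have hX := constantCoeff_X_pow hr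
  refine ⟨fun ⟨h, hy⟩ => ?_, by rintro rfl; exact ⟨lambertX_pow hr, hX⟩⟩
  let a : PowerSeries ℂ := X * fexp (-(C (r : ℂ) * X))
  have ha : coeff 1 a = 1 := by
    rw [coeff_succ_X_mul 0, coeff_zero_eq_constantCoeff_apply,
      ← constantCoeff_fexp (f := -(C (r : ℂ) * X)) (by simp)]
  have hsubst {u : PowerSeries ℂ} (hu : constantCoeff u = 0) :
      a.subst u = u * fexp (-(C (r : ℂ) * u)) := by
    have hs : HasSubst u := .of_constantCoeff_zero' hu
    rw [subst_mul hs, subst_fexp hu (by simp), ← neg_mul, ← map_neg, subst_C_mul hs, subst_X hs,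
      map_neg, neg_mul]
  refine subst_left_injective (a := a) (by simp [a]) (ha ▸ isUnit_one) hy hX ?_
  rw [hsubst hy, hsubst hX, ← lambertX_pow hr]
  exact h.symm

end Curve

end FormalSeries

/-! ### The Riemann-Hurwitz inequality -/

section RiemannHurwitz

open Equiv Equiv.Perm

variable {X : Type*}

theorem sameCycle_setoid_le_iff {σ : Perm X} {R : Setoid X} :
    SameCycle.setoid σ ≤ R ↔ ∀ x, R (σ x) x := by
  refine ⟨fun h x => h (sameCycle_apply_left.mpr (.refl σ x)), ?_⟩
  rintro h x _ ⟨n, rfl⟩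
  refine R.symm ?_
  induction n with
  | zero => exact R.refl x
  | succ n ih =>
    rw [add_comm, zpow_one_add, mul_apply]
    exact R.trans (h _) ih
  | pred n ih =>
    refine R.trans (R.symm ?_) ih
    have hstep := h ((σ ^ (-(n : ℤ) - 1)) x)
    rwa [← mul_apply, ← zpow_one_add, add_sub_cancel] at hstep

theorem sameCycle_setoid_mul_le (σ τ : Perm X) :
    SameCycle.setoid (σ * τ) ≤ SameCycle.setoid σ ⊔ SameCycle.setoid τ :=
  sameCycle_setoid_le_iff.mpr fun x =>
    Setoid.trans' _ (sameCycle_setoid_le_iff.mp le_sup_left (τ x))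
      (sameCycle_setoid_le_iff.mp le_sup_right x)

theorem sameCycle_setoid_list_prod_le (l : List (Perm X)) :
    SameCycle.setoid l.prod ≤ ⨆ τ ∈ l, SameCycle.setoid τ := by
  induction l with
  | nil => exact sameCycle_setoid_le_iff.mpr fun x => Setoid.refl' _ x
  | cons τ l ih =>
    simp only [List.prod_cons, List.mem_cons, iSup_or, iSup_sup_eq, iSup_iSup_eq_left]
    exact (sameCycle_setoid_mul_le τ l.prod).trans (sup_le_sup_left ih _)

/-- The number of cycles of a permutation, fixed points included. -/
def cycleCount (σ : Perm X) : ℕ := Nat.card (Quotient (SameCycle.setoid σ))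

section Swap

variable [DecidableEq X] {a b : X} {σ : Perm X}

theorem sameCycle_setoid_swap_le_iff {R : Setoid X} :
    SameCycle.setoid (swap a b) ≤ R ↔ R a b := by
  rw [sameCycle_setoid_le_iff]
  refine ⟨fun h => by simpa using h b, fun h x => ?_⟩
  rcases eq_or_ne x a with rfl | hxa
  · simpa using R.symm h
  rcases eq_or_ne x b with rfl | hxb
  · simpa using h
  · rw [swap_apply_of_ne_of_ne hxa hxb]

theorem card_quotient_eq_card_sup_swap_add_one [Finite X] {R : Setoid X} (h : ¬ R a b) :
    Nat.card (Quotient R) =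
      Nat.card (Quotient (R ⊔ SameCycle.setoid (swap a b))) + 1 := by
  classical
  let f : X → Quotient R := fun x => if R x b then ⟦a⟧ else ⟦x⟧
  have hker : R ⊔ SameCycle.setoid (swap a b) = Setoid.ker f := by
    refine le_antisymm (sup_le (fun x y hxy => ?_) ?_) fun x y hxy => ?_
    · have hiff : R x b ↔ R y b := ⟨R.trans (R.symm hxy), R.trans hxy⟩
      simp only [Setoid.ker_def, f, hiff, Quotient.sound hxy]
    · rw [sameCycle_setoid_swap_le_iff, Setoid.ker_def]
      simp only [f, if_neg h, if_pos (R.refl b)]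
    · let g : Quotient R → Quotient (R ⊔ SameCycle.setoid (swap a b)) :=
        Quotient.map' id fun _ _ hxy => Setoid.le_def.mp le_sup_left hxy
      have hgf (z : X) : g (f z) = ⟦z⟧ := by
        by_cases hz : R z b
        · refine (congrArg g (if_pos hz)).trans (Quotient.sound ?_)
          exact Setoid.trans' _ (sameCycle_setoid_swap_le_iff.mp le_sup_right)
            (Setoid.le_def.mp le_sup_left (R.symm hz))
        · exact congrArg g (if_neg hz)
      exact Quotient.exact ((hgf x).symm.trans ((congrArg g hxy).trans (hgf y)))
  have hrange : Set.range f = {q | q ≠ ⟦b⟧} := by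
    ext q
    induction q using Quotient.inductionOn with | _ y
    simp only [Set.mem_range, Set.mem_ofPred_eq, ne_eq, Quotient.eq]
    refine ⟨?_, fun hy => ⟨y, if_neg hy⟩⟩
    rintro ⟨x, hx⟩ hy
    by_cases hxb : R x b
    · simp only [f, if_pos hxb] at hx
      exact h (R.trans (Quotient.exact hx) hy)
    · simp only [f, if_neg hxb] at hx
      exact hxb (R.trans (Quotient.exact hx) hy)
  rw [hker, Nat.card_congr (Setoid.quotientKerEquivRange f), hrange,
    ← Nat.card_congr (Equiv.optionSubtypeNe (⟦b⟧ : Quotient R)), Finite.card_option]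
  rfl

variable [Finite X]

theorem sameCycle_mul_swap_of_not_sameCycle (h : ¬ σ.SameCycle a b) :
    (σ * swap a b).SameCycle a b := by
  by_contra hab
  have hpow (n : ℕ) : (σ * swap a b).SameCycle b ((σ ^ (n + 1)) a) := by
    induction n with
    | zero => simpa using sameCycle_apply_right.mpr (SameCycle.refl (σ * swap a b) b)
    | succ n ih =>
      have hne_a : (σ ^ (n + 1)) a ≠ a := fun e => hab (e ▸ ih).symm
      have hne_b : (σ ^ (n + 1)) a ≠ b := fun e => h ⟨(n + 1 : ℕ), by rwa [zpow_natCast]⟩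
      have hstep := sameCycle_apply_right.mpr ih
      rwa [mul_apply, swap_apply_of_ne_of_ne hne_a hne_b, ← mul_apply, ← pow_succ'] at hstep
  have hlast := hpow (orderOf σ - 1)
  rw [Nat.sub_add_cancel (orderOf_pos σ), pow_orderOf_eq_one, one_apply] at hlast
  exact hab hlast.symm

-- Otherwise the cycles of `a` under `σ` and `σ * swap a b` have equal supports and opposite signs.
theorem not_sameCycle_mul_swap_of_sameCycle (hab : a ≠ b) (h : σ.SameCycle a b) :
    ¬ (σ * swap a b).SameCycle a b := by
  classical
  have := Fintype.ofFinite X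
  intro hτ
  set τ := σ * swap a b with hτ_def
  have hle : SameCycle.setoid τ ≤ SameCycle.setoid σ :=
    (sameCycle_setoid_mul_le σ _).trans (sup_le le_rfl (sameCycle_setoid_swap_le_iff.mpr h))
  have hge : SameCycle.setoid σ ≤ SameCycle.setoid τ := by
    have hσ : σ = τ * swap a b := by rw [hτ_def, mul_assoc, swap_mul_self, mul_one]
    rw [hσ]
    exact (sameCycle_setoid_mul_le τ _).trans (sup_le le_rfl (sameCycle_setoid_swap_le_iff.mpr hτ))
  have hiff (x : X) : τ.SameCycle a x ↔ σ.SameCycle a x := ⟨fun hx => hle hx, fun hx => hge hx⟩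
  have hσa : σ a ≠ a := fun e => hab (h.eq_of_left e)
  have hτa : τ a ≠ a := fun e => hab (hτ.eq_of_left e)
  have hsupport : (τ.cycleOf a).support = (σ.cycleOf a).support := by
    ext x
    rw [mem_support_cycleOf_iff' hτa, mem_support_cycleOf_iff' hσa, hiff]
  have hmul : τ.cycleOf a = σ.cycleOf a * swap a b := by
    ext x
    have hswap : σ.SameCycle (swap a b x) x :=
      sameCycle_setoid_le_iff.mp
        (sameCycle_setoid_swap_le_iff (R := SameCycle.setoid σ).mpr h) x
    simp only [mul_apply, cycleOf_apply, hiff]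
    by_cases hx : σ.SameCycle a x
    · rw [if_pos hx, if_pos (hx.trans hswap.symm), hτ_def, mul_apply]
    · rw [if_neg hx, if_neg fun hx' => hx (hx'.trans hswap), swap_apply_of_ne_of_ne]
      · rintro rfl
        exact hx (.refl _ _)
      · rintro rfl
        exact hx h
  have hsign := congrArg sign hmul
  rw [Perm.sign_mul, sign_swap hab, (isCycle_cycleOf τ hτa).sign, (isCycle_cycleOf σ hσa).sign,
    hsupport] at hsign
  simp at hsign

theorem sameCycle_setoid_mul_swap (h : ¬ σ.SameCycle a b) :
    SameCycle.setoid (σ * swap a b) = SameCycle.setoid σ ⊔ SameCycle.setoid (swap a b) := by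
  have hswap : SameCycle.setoid (swap a b) ≤ SameCycle.setoid (σ * swap a b) :=
    sameCycle_setoid_swap_le_iff.mpr (sameCycle_mul_swap_of_not_sameCycle h)
  refine (sameCycle_setoid_mul_le _ _).antisymm (sup_le ?_ hswap)
  simpa [mul_assoc, sup_eq_left.mpr hswap] using
    sameCycle_setoid_mul_le (σ * swap a b) (swap a b)

theorem cycleCount_eq_cycleCount_mul_swap_add_one (h : ¬ σ.SameCycle a b) :
    cycleCount σ = cycleCount (σ * swap a b) + 1 := by
  rw [cycleCount, card_quotient_eq_card_sup_swap_add_one (R := SameCycle.setoid σ) h, cycleCount,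
    sameCycle_setoid_mul_swap h]

theorem cycleCount_mul_swap_eq_cycleCount_add_one (hab : a ≠ b) (h : σ.SameCycle a b) :
    cycleCount (σ * swap a b) = cycleCount σ + 1 := by
  simpa [mul_assoc] using
    cycleCount_eq_cycleCount_mul_swap_add_one (not_sameCycle_mul_swap_of_sameCycle hab h)

end Swap

section Inequality

variable [Finite X] [DecidableEq X] {α : Perm X} {l : List (Perm X)}

theorem even_cycleCount_add (hl : ∀ τ ∈ l, τ.IsSwap) :
    Even (cycleCount (α * l.prod) + cycleCount α + l.length) := by
  induction l using List.reverseRecOn with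
  | nil => simp
  | append_singleton l τ ih =>
    obtain ⟨a, b, hab, rfl⟩ := hl τ (by simp)
    obtain ⟨m, hm⟩ := ih fun τ hτ => hl τ (by simp [hτ])
    rw [List.prod_append, List.prod_singleton, List.length_append, List.length_singleton,
      ← mul_assoc]
    by_cases hs : (α * l.prod).SameCycle a b
    · rw [cycleCount_mul_swap_eq_cycleCount_add_one hab hs]
      exact ⟨m + 1, by omega⟩
    · have hsplit := cycleCount_eq_cycleCount_mul_swap_add_one hs
      exact ⟨m, by omega⟩

theorem cycleCount_add_cycleCount_le (hl : ∀ τ ∈ l, τ.IsSwap) :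
    cycleCount (α * l.prod) + cycleCount α ≤
      2 * Nat.card (Quotient (SameCycle.setoid α ⊔ ⨆ τ ∈ l, SameCycle.setoid τ)) +
        l.length := by
  induction l using List.reverseRecOn with
  | nil => simp [cycleCount, two_mul]
  | append_singleton l τ ih =>
    obtain ⟨a, b, hab, rfl⟩ := hl τ (by simp)
    have ih' := ih fun τ hτ => hl τ (by simp [hτ])
    set R := SameCycle.setoid α ⊔ ⨆ τ ∈ l, SameCycle.setoid τ
    have hR : SameCycle.setoid α ⊔ ⨆ τ ∈ l ++ [swap a b], SameCycle.setoid τ =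
        R ⊔ SameCycle.setoid (swap a b) := by
      simp only [List.mem_append, List.mem_singleton, iSup_or, iSup_sup_eq, iSup_iSup_eq_left,
        R, sup_assoc]
    rw [hR, List.prod_append, List.prod_singleton, List.length_append, List.length_singleton,
      ← mul_assoc]
    by_cases hs : (α * l.prod).SameCycle a b
    · have hRab : R a b :=
        (sameCycle_setoid_mul_le α l.prod).trans
          (sup_le_sup_left (sameCycle_setoid_list_prod_le l) _) hs
      rw [cycleCount_mul_swap_eq_cycleCount_add_one hab hs,
        sup_eq_left.mpr (sameCycle_setoid_swap_le_iff.mpr hRab)]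
      omega
    · have hsplit := cycleCount_eq_cycleCount_mul_swap_add_one hs
      by_cases hRab : R a b
      · rw [sup_eq_left.mpr (sameCycle_setoid_swap_le_iff.mpr hRab)]
        omega
      · have hcard := card_quotient_eq_card_sup_swap_add_one hRab
        omega

end Inequality

theorem cycleCount_pos [Finite X] [Nonempty X] (σ : Perm X) : 0 < cycleCount σ :=
  have : Nonempty (Quotient (SameCycle.setoid σ)) := ⟨⟦Classical.arbitrary X⟧⟩
  Nat.card_pos

theorem card_sameCycle [Finite X] (α : Perm X) (y : X) :
    Nat.card {x // α.SameCycle x y} = Function.minimalPeriod α y := by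
  have := Fintype.ofFinite (MulAction.orbit (Subgroup.zpowers α) y)
  have hperiod : Function.minimalPeriod α y = Function.minimalPeriod (α • ·) y := rfl
  rw [hperiod, MulAction.minimalPeriod_eq_card, ← Nat.card_eq_fintype_card]
  refine Nat.card_congr (Equiv.subtypeEquivRight fun x => ?_)
  constructor
  · intro hx
    obtain ⟨n, hn⟩ := hx.symm
    exact ⟨⟨α ^ n, n, rfl⟩, hn⟩
  · rintro ⟨⟨_, n, rfl⟩, hn⟩
    exact SameCycle.symm ⟨n, hn⟩

theorem card_eq_mul_cycleCount [Finite X] {r : ℕ} {α : Perm X}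
    (h : ∀ x, Function.minimalPeriod α x = r) : Nat.card X = r * cycleCount α := by
  have := Fintype.ofFinite (Quotient (SameCycle.setoid α))
  have hfiber (q : Quotient (SameCycle.setoid α)) : Nat.card {x // ⟦x⟧ = q} = r := by
    induction q using Quotient.inductionOn with | _ y
    rw [← h y, ← card_sameCycle]
    exact Nat.card_congr (Equiv.subtypeEquivRight fun x => Quotient.eq)
  rw [← Nat.card_congr (Equiv.sigmaFiberEquiv (Quotient.mk (SameCycle.setoid α))), Nat.card_sigma]
  simp only [hfiber, Finset.sum_const, Finset.card_univ, ← Nat.card_eq_fintype_card, smul_eq_mul,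
    mul_comm, cycleCount]

end RiemannHurwitz

/-! ### Connectedness -/

section Connected

open Equiv Equiv.Perm

variable {X I : Type*}

/-- The monodromy `(α, τ)` of a branched covering with sheets `X`: `α` around `0`, and `τ i` around
the simple branch point `i`. -/
abbrev MonodromyData (X I : Type*) : Type _ := Perm X × (I → Perm X)

/-- Invariance of a set of sheets under the monodromy: it is a union of connected components. -/
def IsInvariant (c : MonodromyData X I) (A : Set X) : Prop :=
  (∀ x, c.1 x ∈ A ↔ x ∈ A) ∧ ∀ i x, c.2 i x ∈ A ↔ x ∈ A

/-- Connectedness of a covering in terms of its monodromy. -/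
def IsConnectedCover (c : MonodromyData X I) : Prop :=
  ∀ A : Set X, A.Nonempty → IsInvariant c A → A = Set.univ

theorem IsInvariant.compl {c : MonodromyData X I} {A : Set X} (hA : IsInvariant c A) :
    IsInvariant c Aᶜ :=
  ⟨fun x => not_congr (hA.1 x), fun i x => not_congr (hA.2 i x)⟩

theorem IsInvariant.mem_closure {c : MonodromyData X I} {A : Set X} (hA : IsInvariant c A)
    {g : Perm X} (hg : g ∈ Subgroup.closure (insert c.1 (Set.range c.2))) (x : X) :
    g x ∈ A ↔ x ∈ A := by
  induction hg using Subgroup.closure_induction generalizing x with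
  | mem g hg =>
    rcases hg with rfl | ⟨i, rfl⟩
    exacts [hA.1 x, hA.2 i x]
  | one => rfl
  | mul g g' _ _ hg hg' => rw [mul_apply, hg, hg']
  | inv g _ hg => rw [← hg, ← mul_apply, mul_inv_cancel, one_apply]

theorem isPretransitive_closure_iff (c : MonodromyData X I) :
    MulAction.IsPretransitive (Subgroup.closure (insert c.1 (Set.range c.2))) X ↔
      IsConnectedCover c := by
  constructor
  · rintro h A ⟨x, hx⟩ hA
    refine Set.eq_univ_of_forall fun y => ?_
    obtain ⟨⟨g, hg⟩, rfl⟩ := h.exists_smul_eq x y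
    exact (hA.mem_closure hg x).mpr hx
  · refine fun h => ⟨fun x y => ?_⟩
    set G := Subgroup.closure (insert c.1 (Set.range c.2))
    have hmem {g : Perm X} (hg : g ∈ G) (z : X) :
        g z ∈ MulAction.orbit G x ↔ z ∈ MulAction.orbit G x := by
      rw [← MulAction.orbit_eq_iff, ← MulAction.orbit_eq_iff, ← MulAction.orbit_smul ⟨g, hg⟩ z]
      rfl
    have huniv := h (MulAction.orbit G x) ⟨x, MulAction.mem_orbit_self x⟩
      ⟨hmem (Subgroup.subset_closure (Set.mem_insert _ _)),
        fun i => hmem (Subgroup.subset_closure (Set.mem_insert_of_mem _ ⟨i, rfl⟩))⟩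
    exact Set.eq_univ_iff_forall.mp huniv y

theorem IsConnectedCover.setoid_eq_top {c : MonodromyData X I} (hc : IsConnectedCover c)
    {R : Setoid X} (hzeros : SameCycle.setoid c.1 ≤ R)
    (hsimple : ∀ i, SameCycle.setoid (c.2 i) ≤ R) :
    R = ⊤ := by
  refine Setoid.eq_top_iff.mpr fun x y => ?_
  have hmem {σ : Perm X} (hσ : SameCycle.setoid σ ≤ R) (z : X) : R (σ z) y ↔ R z y :=
    have hz := sameCycle_setoid_le_iff.mp hσ z
    ⟨R.trans (R.symm hz), R.trans hz⟩
  exact Set.eq_univ_iff_forall.mp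
    (hc {z | R z y} ⟨y, R.refl y⟩ ⟨hmem hzeros, fun i => hmem (hsimple i)⟩) x

/-- The monodromy around the point whose preimages are the poles. -/
def monodromyAtInfinity {s : ℕ} (c : MonodromyData X (Fin s)) : Perm X :=
  c.1 * (List.ofFn c.2).prod

theorem IsConnectedCover.exists_genus [Finite X] [DecidableEq X] {s : ℕ}
    {c : MonodromyData X (Fin s)} (hc : IsConnectedCover c) (hsimple : ∀ i, (c.2 i).IsSwap) :
    ∃ g, 2 * g + cycleCount (monodromyAtInfinity c) + cycleCount c.1 = s + 2 := by
  have hswap : ∀ τ ∈ List.ofFn c.2, τ.IsSwap := by simpa [List.mem_ofFn'] using hsimple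
  have hle := cycleCount_add_cycleCount_le (α := c.1) hswap
  have heven := even_cycleCount_add (α := c.1) hswap
  have htop : SameCycle.setoid c.1 ⊔ ⨆ τ ∈ List.ofFn c.2, SameCycle.setoid τ = ⊤ :=
    hc.setoid_eq_top le_sup_left fun i => le_sup_of_le_right
      (le_iSup₂ (f := fun τ _ => SameCycle.setoid τ) (c.2 i)
        ((List.mem_ofFn' _ _).mpr ⟨i, rfl⟩))
  have hcard := Finite.card_le_one_iff_subsingleton.mpr (Quotient.subsingleton_iff.mpr htop)
  rw [List.length_ofFn] at hle heven
  obtain ⟨q, hq⟩ := heven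
  refine ⟨s + 1 - q, ?_⟩
  rw [monodromyAtInfinity]
  omega

end Connected

/-! ### Coverings and their connected components -/

section Covers

open Equiv Equiv.Perm

theorem minimalPeriod_apply_of_injective {X Y : Type*} {f : X → X} {g : Y → Y} {ι : X → Y}
    (hι : Function.Injective ι) (h : Function.Semiconj ι f g) (x : X) :
    Function.minimalPeriod g (ι x) = Function.minimalPeriod f x := by
  rw [Function.minimalPeriod_eq_minimalPeriod_iff]
  intro n
  rw [Function.IsPeriodicPt, Function.IsFixedPt, ← h.iterate_right n, hι.eq_iff]
  rfl

theorem forall_iff_forall_subtype {I : Type*} (p : I → Prop) {P : I → Prop} :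
    (∀ i, P i) ↔ (∀ i : {i // p i}, P i) ∧ ∀ i : {i // ¬ p i}, P i :=
  ⟨fun h => ⟨fun i => h i, fun i => h i⟩,
    fun h i => (em (p i)).elim (fun hi => h.1 ⟨i, hi⟩) fun hi => h.2 ⟨i, hi⟩⟩

theorem forall_ofSubtype_mem_iff {X : Type*} {p : X → Prop} [DecidablePred p]
    (σ : Perm {x // p x}) (V : Set X) :
    (∀ x, ofSubtype σ x ∈ V ↔ x ∈ V) ↔ ∀ x, (σ x : X) ∈ V ↔ ↑x ∈ V := by
  rw [forall_iff_forall_subtype p, and_iff_left fun x => by rw [ofSubtype_apply_of_not_mem _ x.2]]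
  simp only [ofSubtype_apply_coe]

/-- Monodromy data of a not necessarily connected covering that is simply branched over the
points of `I` and all of whose zeros have order `r`; the poles are not labelled. -/
structure IsCover (r : ℕ) {X I : Type*} [DecidableEq X] (c : MonodromyData X I) : Prop where
  zeros : ∀ x, Function.minimalPeriod c.1 x = r
  simple : ∀ i, (c.2 i).IsSwap

/-- The number of coverings with sheets `X` and simple branch points `I`. -/
def coverCount (r : ℕ) (X I : Type*) [DecidableEq X] : ℕ :=
  Nat.card {c : MonodromyData X I // IsCover r c}

/-- The number of connected coverings with sheets `X` and simple branch points `I`. -/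
def connectedCount (r : ℕ) (X I : Type*) [DecidableEq X] : ℕ :=
  Nat.card {c : MonodromyData X I // IsCover r c ∧ IsConnectedCover c}

section Congr

variable {r : ℕ} {X Y I J : Type*}

/-- Transport of monodromy data along bijections of sheets and of branch points. -/
def monodromyDataCongr (e : X ≃ Y) (f : I ≃ J) : MonodromyData X I ≃ MonodromyData Y J :=
  Equiv.prodCongr e.permCongr (Equiv.arrowCongr f e.permCongr)

theorem isInvariant_monodromyDataCongr (e : X ≃ Y) (f : I ≃ J) (c : MonodromyData X I)
    (A : Set Y) : IsInvariant (monodromyDataCongr e f c) A ↔ IsInvariant c (e ⁻¹' A) := by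
  simp [IsInvariant, monodromyDataCongr, ← e.forall_congr_right, ← f.forall_congr_right]

theorem isConnectedCover_monodromyDataCongr (e : X ≃ Y) (f : I ≃ J) (c : MonodromyData X I) :
    IsConnectedCover (monodromyDataCongr e f c) ↔ IsConnectedCover c := by
  simp only [IsConnectedCover, isInvariant_monodromyDataCongr]
  refine (Equiv.Set.congr e).symm.forall_congr fun A => ?_
  rw [Equiv.Set.congr_symm_apply, Set.image_nonempty, e.image_symm_eq_preimage,
    Set.preimage_eq_univ_iff, e.range_eq_univ, Set.univ_subset_iff]

theorem isSwap_permCongr [DecidableEq X] [DecidableEq Y] (e : X ≃ Y) (σ : Perm X) :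
    (e.permCongr σ).IsSwap ↔ σ.IsSwap := by
  have hswap (a b : X) : e.permCongr (swap a b) = swap (e a) (e b) := by
    rw [permCongr_def, Equiv.symm_trans_swap_trans]
  simp only [IsSwap, ← e.exists_congr_right, ← hswap, e.permCongr.injective.eq_iff,
    e.injective.ne_iff]

theorem isCover_monodromyDataCongr [DecidableEq X] [DecidableEq Y] (e : X ≃ Y) (f : I ≃ J)
    (c : MonodromyData X I) : IsCover r (monodromyDataCongr e f c) ↔ IsCover r c := by
  have hperiod (x : X) : Function.minimalPeriod (e.permCongr c.1) (e x) =
      Function.minimalPeriod c.1 x :=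
    minimalPeriod_apply_of_injective e.injective (fun z => by simp) x
  have hzeros : (∀ y, Function.minimalPeriod (e.permCongr c.1) y = r) ↔
      ∀ x, Function.minimalPeriod c.1 x = r := by
    simp only [← e.forall_congr_right, hperiod]
  have hsimple : (∀ j, (e.permCongr (c.2 (f.symm j))).IsSwap) ↔ ∀ i, (c.2 i).IsSwap := by
    simp only [isSwap_permCongr, f.symm.forall_congr_right (q := fun i => (c.2 i).IsSwap)]
  exact ⟨fun h => ⟨hzeros.mp h.zeros, hsimple.mp h.simple⟩,
    fun h => ⟨hzeros.mpr h.zeros, hsimple.mpr h.simple⟩⟩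

variable [DecidableEq X] [DecidableEq Y]

theorem coverCount_congr (e : X ≃ Y) (f : I ≃ J) : coverCount r X I = coverCount r Y J :=
  Nat.card_congr (Equiv.subtypeEquiv (monodromyDataCongr e f)
    fun c => (isCover_monodromyDataCongr e f c).symm)

theorem connectedCount_congr (e : X ≃ Y) (f : I ≃ J) :
    connectedCount r X I = connectedCount r Y J :=
  Nat.card_congr (Equiv.subtypeEquiv (monodromyDataCongr e f) fun c =>
    and_congr (isCover_monodromyDataCongr e f c).symm
      (isConnectedCover_monodromyDataCongr e f c).symm)

end Congr

section Component

variable {X I : Type*}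

/-- The sheets of the connected component of the sheet `x`. -/
def component (c : MonodromyData X I) (x : X) : Set X :=
  {y | ∀ A, IsInvariant c A → x ∈ A → y ∈ A}

/-- The branch points of the part of a covering with sheets `A`. -/
def branchPoints (c : MonodromyData X I) (A : Set X) : Set I :=
  {i | ∃ x ∈ A, c.2 i x ≠ x}

theorem mem_component_self (c : MonodromyData X I) (x : X) : x ∈ component c x :=
  fun _ _ hx => hx

theorem isInvariant_component (c : MonodromyData X I) (x : X) : IsInvariant c (component c x) :=
  ⟨fun z => forall₂_congr fun _ hA => imp_congr_right fun _ => hA.1 z,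
    fun i z => forall₂_congr fun _ hA => imp_congr_right fun _ => hA.2 i z⟩

theorem isConnectedCover_iff_component_eq_univ {c : MonodromyData X I} (x : X) :
    IsConnectedCover c ↔ component c x = Set.univ := by
  refine ⟨fun h => h _ ⟨x, mem_component_self c x⟩ (isInvariant_component c x), ?_⟩
  rintro h A ⟨y, hy⟩ hA
  have hmem {B : Set X} (hB : IsInvariant c B) (hx : x ∈ B) (z : X) : z ∈ B :=
    Set.eq_univ_iff_forall.mp h z B hB hx
  by_cases hx : x ∈ A
  · exact Set.eq_univ_of_forall (hmem hA hx)
  · exact absurd hy (hmem hA.compl hx y)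

theorem IsInvariant.mem_iff_of_isCycle {c : MonodromyData X I} {A : Set X} (hA : IsInvariant c A)
    {i : I} (hi : (c.2 i).IsCycle) {x y : X} (hx : c.2 i x ≠ x) (hy : c.2 i y ≠ y) :
    x ∈ A ↔ y ∈ A :=
  have hker : SameCycle.setoid (c.2 i) ≤ Setoid.ker (· ∈ A) :=
    sameCycle_setoid_le_iff.mpr fun z => propext (hA.2 i z)
  iff_of_eq (hker (hi.sameCycle hx hy))

end Component

section Glue

variable {r : ℕ} {X I : Type*} [DecidableEq X] [DecidableEq I]

/-- The disjoint union of a covering with sheets `A` and branch points `B` and one with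
the complementary sheets and branch points. -/
def glue (A : Finset X) (B : Finset I) (c : MonodromyData {x // x ∈ A} {i // i ∈ B})
    (c' : MonodromyData {x // x ∉ A} {i // i ∉ B}) : MonodromyData X I :=
  (c.1.subtypeCongr c'.1,
    fun i => if hi : i ∈ B then ofSubtype (c.2 ⟨i, hi⟩) else ofSubtype (c'.2 ⟨i, hi⟩))

variable {A : Finset X} {B : Finset I} {c : MonodromyData {x // x ∈ A} {i // i ∈ B}}
  {c' : MonodromyData {x // x ∉ A} {i // i ∉ B}}

theorem glue_snd_of_mem (i : {i // i ∈ B}) : (glue A B c c').2 i = ofSubtype (c.2 i) :=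
  dif_pos i.2

theorem glue_snd_of_notMem (i : {i // i ∉ B}) : (glue A B c c').2 i = ofSubtype (c'.2 i) :=
  dif_neg i.2

theorem glue_inj {d : MonodromyData {x // x ∈ A} {i // i ∈ B}}
    {d' : MonodromyData {x // x ∉ A} {i // i ∉ B}} :
    glue A B c c' = glue A B d d' ↔ c = d ∧ c' = d' := by
  have hfst : (glue A B c c').1 = (glue A B d d').1 ↔ c.1 = d.1 ∧ c'.1 = d'.1 :=
    ((Perm.subtypeCongrHom_injective (· ∈ A)).eq_iff (a := (c.1, c'.1)) (b := (d.1, d'.1))).trans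
      Prod.mk_inj
  simp only [Prod.ext_iff (x := glue A B c c'), hfst, funext_iff, forall_iff_forall_subtype (· ∈ B),
    glue_snd_of_mem, glue_snd_of_notMem, ofSubtype_injective.eq_iff]
  rw [Prod.ext_iff, Prod.ext_iff, funext_iff, funext_iff, and_and_and_comm]

theorem isInvariant_glue_iff {V : Set X} : IsInvariant (glue A B c c') V ↔
    IsInvariant c (Subtype.val ⁻¹' V) ∧ IsInvariant c' (Subtype.val ⁻¹' V) := by
  have hfst : (∀ x, (glue A B c c').1 x ∈ V ↔ x ∈ V) ↔
      (∀ x, (c.1 x : X) ∈ V ↔ ↑x ∈ V) ∧ ∀ x, (c'.1 x : X) ∈ V ↔ ↑x ∈ V := by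
    rw [forall_iff_forall_subtype (· ∈ A)]
    simp only [glue, Perm.subtypeCongr.left_apply_subtype, Perm.subtypeCongr.right_apply_subtype]
  have hsnd : (∀ i x, (glue A B c c').2 i x ∈ V ↔ x ∈ V) ↔
      (∀ i x, (c.2 i x : X) ∈ V ↔ ↑x ∈ V) ∧ ∀ i x, (c'.2 i x : X) ∈ V ↔ ↑x ∈ V := by
    rw [forall_iff_forall_subtype (· ∈ B)]
    simp only [glue_snd_of_mem, glue_snd_of_notMem, forall_ofSubtype_mem_iff]
  rw [IsInvariant, hfst, hsnd, and_and_and_comm]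
  rfl

theorem isSwap_ofSubtype {p : X → Prop} [DecidablePred p] {σ : Perm {x // p x}} [Finite X] :
    (ofSubtype σ).IsSwap ↔ σ.IsSwap := by
  have := Fintype.ofFinite X
  rw [isSwap_iff_cycleType, isSwap_iff_cycleType, cycleType_ofSubtype]

theorem isCover_glue [Finite X] :
    IsCover r (glue A B c c') ↔ IsCover r c ∧ IsCover r c' := by
  have hzeros : (∀ x, Function.minimalPeriod (glue A B c c').1 x = r) ↔
      (∀ x, Function.minimalPeriod c.1 x = r) ∧ ∀ x, Function.minimalPeriod c'.1 x = r := by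
    have hmem (x : {x // x ∈ A}) : Function.minimalPeriod (glue A B c c').1 x =
        Function.minimalPeriod c.1 x :=
      minimalPeriod_apply_of_injective Subtype.val_injective (fun z => by simp [glue]) x
    have hnotMem (x : {x // x ∉ A}) : Function.minimalPeriod (glue A B c c').1 x =
        Function.minimalPeriod c'.1 x :=
      minimalPeriod_apply_of_injective Subtype.val_injective (fun z => by simp [glue]) x
    simp only [forall_iff_forall_subtype (· ∈ A), hmem, hnotMem]
  have hsimple : (∀ i, ((glue A B c c').2 i).IsSwap) ↔
      (∀ i, (c.2 i).IsSwap) ∧ ∀ i, (c'.2 i).IsSwap := by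
    simp only [forall_iff_forall_subtype (· ∈ B), glue_snd_of_mem, glue_snd_of_notMem,
      isSwap_ofSubtype]
  constructor
  · intro h
    obtain ⟨hz, hz'⟩ := hzeros.mp h.zeros
    obtain ⟨hs, hs'⟩ := hsimple.mp h.simple
    exact ⟨⟨hz, hs⟩, ⟨hz', hs'⟩⟩
  · rintro ⟨h, h'⟩
    exact ⟨hzeros.mpr ⟨h.zeros, h'.zeros⟩, hsimple.mpr ⟨h.simple, h'.simple⟩⟩

theorem component_glue {x : X} (hx : x ∈ A) :
    component (glue A B c c') x = Subtype.val '' component c ⟨x, hx⟩ := by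
  ext y
  constructor
  · intro hy
    have hempty : Subtype.val ⁻¹' (Subtype.val '' component c ⟨x, hx⟩) =
        (∅ : Set {x // x ∉ A}) := by
      ext z
      simpa using fun hz => absurd hz z.2
    refine hy _ (isInvariant_glue_iff.mpr ⟨?_, ?_⟩) ⟨_, mem_component_self c _, rfl⟩
    · rw [Set.preimage_image_eq _ Subtype.val_injective]
      exact isInvariant_component c _
    · simp [hempty, IsInvariant]
  · rintro ⟨y, hy, rfl⟩ V hV hxV
    exact hy _ (isInvariant_glue_iff.mp hV).1 hxV

theorem component_glue_eq_iff {x : X} (hx : x ∈ A) :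
    component (glue A B c c') x = A ↔ IsConnectedCover c := by
  have hA : (A : Set X) = Subtype.val '' (Set.univ : Set {x // x ∈ A}) := by simp
  rw [component_glue hx, isConnectedCover_iff_component_eq_univ ⟨x, hx⟩, hA,
    Subtype.val_injective.image_injective.eq_iff]

theorem branchPoints_glue (hc : ∀ i, c.2 i ≠ 1) : branchPoints (glue A B c c') A = B := by
  ext i
  by_cases hi : i ∈ B
  · obtain ⟨x, hx⟩ := not_forall.mp (mt Perm.ext (hc ⟨i, hi⟩))
    refine iff_of_true ⟨x, x.2, ?_⟩ hi
    rwa [glue_snd_of_mem ⟨i, hi⟩, ofSubtype_apply_coe, Subtype.coe_ne_coe]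
  · refine iff_of_false ?_ hi
    rintro ⟨x, hx, hne⟩
    rw [glue_snd_of_notMem ⟨i, hi⟩] at hne
    exact hne (ofSubtype_apply_of_not_mem _ (not_not.mpr hx))

theorem exists_glue_eq {C : MonodromyData X I} (hC : ∀ i, (C.2 i).IsCycle)
    (hA : IsInvariant C A) (hB : branchPoints C A = B) : ∃ c c', glue A B c c' = C := by
  refine ⟨(C.1.subtypePerm hA.1, fun i => (C.2 i).subtypePerm (hA.2 i)),
    (C.1.subtypePerm hA.compl.1, fun i => (C.2 i).subtypePerm (hA.compl.2 i)),
    Prod.ext ?_ (funext ?_)⟩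
  · exact Perm.ext ((forall_iff_forall_subtype (· ∈ A)).mpr (by simp [glue]))
  · refine (forall_iff_forall_subtype (· ∈ B)).mpr ⟨fun i => ?_, fun i => ?_⟩
    · obtain ⟨y, hy, hne⟩ : i.1 ∈ branchPoints C A := hB ▸ i.2
      rw [glue_snd_of_mem]
      exact ofSubtype_subtypePerm (hA.2 i) fun x hx => (hA.mem_iff_of_isCycle (hC i) hne hx).mp hy
    · rw [glue_snd_of_notMem]
      refine ofSubtype_subtypePerm (hA.compl.2 i) fun x hx hxA => i.2 ?_
      rw [← Finset.mem_coe, ← hB]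
      exact ⟨x, hxA, hx⟩

end Glue

section Decomposition

variable {r : ℕ} {X I : Type*} [DecidableEq X]

theorem card_cover_component_eq [Finite X] {A : Finset X} {B : Finset I} {x : X} (hx : x ∈ A) :
    Nat.card {C : MonodromyData X I //
      IsCover r C ∧ component C x = A ∧ branchPoints C A = B} =
    connectedCount r {x // x ∈ A} {i // i ∈ B} * coverCount r {x // x ∉ A} {i // i ∉ B} := by
  classical
  rw [connectedCount, coverCount, ← Nat.card_prod]
  symm
  refine Nat.card_congr (Equiv.ofBijective (fun p => ⟨glue A B p.1.1 p.2.1,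
    isCover_glue.mpr ⟨p.1.2.1, p.2.2⟩, (component_glue_eq_iff hx).mpr p.1.2.2,
    branchPoints_glue fun i => (p.1.2.1.simple i).isCycle.ne_one⟩) ⟨fun p q h => ?_, ?_⟩)
  · obtain ⟨hfst, hsnd⟩ := glue_inj.mp (congrArg Subtype.val h)
    exact Prod.ext (Subtype.ext hfst) (Subtype.ext hsnd)
  · rintro ⟨C, hC, hcomp, hbranch⟩
    obtain ⟨c, c', rfl⟩ := exists_glue_eq (fun i => (hC.simple i).isCycle)
      (hcomp ▸ isInvariant_component C x) hbranch
    obtain ⟨hc, hc'⟩ := isCover_glue.mp hC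
    exact ⟨⟨⟨c, hc, (component_glue_eq_iff hx).mp hcomp⟩, ⟨c', hc'⟩⟩, rfl⟩

variable [Fintype X] [Fintype I]

theorem coverCount_eq_sum (r : ℕ) (x : X) : coverCount r X I =
    ∑ A : Finset X, ∑ B : Finset I, if x ∈ A then
      connectedCount r {x // x ∈ A} {i // i ∈ B} * coverCount r {x // x ∉ A} {i // i ∉ B}
    else 0 := by
  classical
  let key (C : {C : MonodromyData X I // IsCover r C}) : Finset X × Finset I :=
    ((component C.1 x).toFinset, (branchPoints C.1 (component C.1 x)).toFinset)
  have hkey {A B} (C) : key C = (A, B) ↔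
      component C.1 x = A ∧ branchPoints C.1 A = B := by
    simp only [key, Prod.mk.injEq, ← Finset.coe_inj, Set.coe_toFinset]
    exact and_congr_right fun h => by rw [h]
  rw [coverCount, ← Nat.card_congr (Equiv.sigmaFiberEquiv key), Nat.card_sigma,
    Fintype.sum_prod_type]
  refine Finset.sum_congr rfl fun A _ => Finset.sum_congr rfl fun B _ => ?_
  split_ifs with hx
  · rw [← card_cover_component_eq hx]
    exact Nat.card_congr ((Equiv.subtypeEquivRight hkey).trans
      (Equiv.subtypeSubtypeEquivSubtypeInter (IsCover r)
        fun C : MonodromyData X I => component C x = (A : Set X) ∧ branchPoints C A = (B : Set I)))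
  · have : IsEmpty {C // key C = (A, B)} :=
      ⟨fun C => hx (Finset.mem_coe.mp (((hkey _).mp C.2).1 ▸ mem_component_self _ x))⟩
    exact Nat.card_of_isEmpty

end Decomposition

theorem sum_finset_apply_card {α M : Type*} [Fintype α] [AddCommMonoid M] (f : ℕ → M) :
    ∑ A : Finset α, f A.card =
      ∑ k ∈ Finset.range (Fintype.card α + 1), (Fintype.card α).choose k • f k := by
  rw [← Finset.powerset_univ, Finset.sum_powerset_apply_card, Finset.card_univ]

/-- A choice of sheet singles out a component. -/
theorem mul_coverCount (r d s : ℕ) : d * coverCount r (Fin d) (Fin s) =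
    ∑ k ∈ Finset.range (d + 1), ∑ t ∈ Finset.range (s + 1), d.choose k * s.choose t *
      (k * connectedCount r (Fin k) (Fin t) * coverCount r (Fin (d - k)) (Fin (s - t))) := by
  set F : ℕ → ℕ → ℕ := fun k t =>
    connectedCount r (Fin k) (Fin t) * coverCount r (Fin (d - k)) (Fin (s - t)) with hF
  have hcount (A : Finset (Fin d)) (B : Finset (Fin s)) :
      connectedCount r {x // x ∈ A} {i // i ∈ B} * coverCount r {x // x ∉ A} {i // i ∉ B} =
        F A.card B.card := by
    rw [connectedCount_congr A.equivFin B.equivFin,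
      coverCount_congr (Fintype.equivFinOfCardEq (n := d - A.card) (by simp))
        (Fintype.equivFinOfCardEq (n := s - B.card) (by simp))]
  calc d * coverCount r (Fin d) (Fin s)
    _ = ∑ x : Fin d, ∑ A : Finset (Fin d), ∑ B : Finset (Fin s),
          if x ∈ A then F A.card B.card else 0 := by
        simp only [← hcount, ← coverCount_eq_sum, Finset.sum_const, Finset.card_univ,
          Fintype.card_fin, smul_eq_mul]
    _ = ∑ A : Finset (Fin d), ∑ B : Finset (Fin s), A.card * F A.card B.card := by
        rw [Finset.sum_comm]
        refine Finset.sum_congr rfl fun A _ => Finset.sum_comm.trans ?_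
        simp only [Finset.sum_ite_mem, Finset.univ_inter, Finset.sum_const, smul_eq_mul]
    _ = ∑ k ∈ Finset.range (d + 1), d.choose k *
          ∑ t ∈ Finset.range (s + 1), s.choose t * (k * F k t) := by
        have hsum (k : ℕ) : ∑ B : Finset (Fin s), k * F k B.card =
            ∑ t ∈ Finset.range (s + 1), s.choose t * (k * F k t) := by
          simpa using sum_finset_apply_card (α := Fin s) fun t => k * F k t
        simpa only [hsum, Fintype.card_fin, smul_eq_mul] using sum_finset_apply_card (α := Fin d)
          fun k => ∑ t ∈ Finset.range (s + 1), s.choose t * (k * F k t)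
    _ = _ := by simp only [Finset.mul_sum, hF, mul_assoc]

end Covers

/-! ### Counting coverings -/

section Counting

open Equiv Equiv.Perm

theorem card_subtype_eq_sum_fiberwise {α β : Type*} [Finite α] {p : α → Prop} {f : α → β}
    {t : Finset β} (h : ∀ a, p a → f a ∈ t) :
    Nat.card {a // p a} = ∑ b ∈ t, Nat.card {a // p a ∧ f a = b} := by
  classical
  have := Fintype.ofFinite α
  have hmaps : Set.MapsTo f (Finset.univ.filter p) t := fun a ha => h a (by simpa using ha)
  simp only [Nat.card_eq_fintype_card, Fintype.card_subtype, ← Finset.filter_filter]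
  exact Finset.card_eq_sum_card_fiberwise hmaps

theorem card_isSwap (X : Type*) [Fintype X] [DecidableEq X] :
    Nat.card {τ : Perm X // τ.IsSwap} = (Fintype.card X).choose 2 := by
  rcases lt_or_ge (Fintype.card X) 2 with hX | hX
  · have : Subsingleton X := Fintype.card_le_one_iff_subsingleton.mp (by omega)
    have : IsEmpty {τ : Perm X // τ.IsSwap} :=
      ⟨fun ⟨_, a, b, hab, _⟩ => hab (Subsingleton.elim a b)⟩
    rw [Nat.card_of_isEmpty, Nat.choose_eq_zero_of_lt hX]
  · simp only [isSwap_iff_cycleType, Nat.card_eq_fintype_card, Fintype.card_subtype]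
    simpa using card_of_cycleType_singleton le_rfl hX

/-- The number of permutations all of whose cycles have length `r`. -/
def zerosCount (r : ℕ) (X : Type*) : ℕ :=
  Nat.card {α : Perm X // ∀ x, Function.minimalPeriod α x = r}

theorem coverCount_eq (r : ℕ) (X I : Type*) [Fintype X] [DecidableEq X] [Fintype I] :
    coverCount r X I = zerosCount r X * (Fintype.card X).choose 2 ^ Fintype.card I := by
  have e : {c : MonodromyData X I // IsCover r c} ≃
      {α : Perm X // ∀ x, Function.minimalPeriod α x = r} × (I → {τ : Perm X // τ.IsSwap}) :=
    { toFun := fun c => (⟨c.1.1, c.2.zeros⟩, fun i => ⟨c.1.2 i, c.2.simple i⟩)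
      invFun := fun p => ⟨(p.1.1, fun i => (p.2 i).1), ⟨p.1.2, fun i => (p.2 i).2⟩⟩
      left_inv := fun _ => rfl
      right_inv := fun _ => rfl }
  rw [coverCount, Nat.card_congr e, Nat.card_prod, Nat.card_fun, card_isSwap, zerosCount,
    Nat.card_eq_fintype_card (α := I)]

theorem zerosCount_eq_zero {r : ℕ} {X : Type*} [Finite X] (h : ¬ r ∣ Nat.card X) :
    zerosCount r X = 0 := by
  have : IsEmpty {α : Perm X // ∀ x, Function.minimalPeriod α x = r} :=
    ⟨fun ⟨_, hα⟩ => h ⟨_, card_eq_mul_cycleCount hα⟩⟩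
  exact Nat.card_of_isEmpty

section CycleType

variable {X : Type*} [Fintype X] [DecidableEq X]

theorem card_support_cycleOf {σ : Perm X} {x : X} (hx : x ∈ σ.support) :
    (σ.cycleOf x).support.card = Function.minimalPeriod σ x := by
  rw [← card_sameCycle, Nat.card_eq_fintype_card, ← Fintype.card_coe]
  refine Fintype.card_congr (Equiv.subtypeEquivRight fun y => ?_)
  rw [mem_support_cycleOf_iff, sameCycle_comm, and_iff_left hx]

theorem mem_cycleType_iff_exists_minimalPeriod {σ : Perm X} {k : ℕ} :
    k ∈ σ.cycleType ↔ ∃ x ∈ σ.support, Function.minimalPeriod σ x = k := by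
  rw [cycleType_def, Multiset.mem_map]
  constructor
  · rintro ⟨c, hc, rfl⟩
    obtain ⟨x, hx⟩ := (mem_cycleFactorsFinset_iff.mp hc).1.nonempty_support
    have hxσ : x ∈ σ.support := mem_cycleFactorsFinset_support_le hc hx
    refine ⟨x, hxσ, ?_⟩
    rw [← card_support_cycleOf hxσ, ← cycle_is_cycleOf hx hc, Function.comp_apply]
  · rintro ⟨x, hx, rfl⟩
    exact ⟨_, cycleOf_mem_cycleFactorsFinset_iff.mpr hx, card_support_cycleOf hx⟩

theorem forall_minimalPeriod_eq_iff_cycleType {r m : ℕ} (hr : 1 < r)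
    (hX : Fintype.card X = r * m) (σ : Perm X) :
    (∀ x, Function.minimalPeriod σ x = r) ↔ σ.cycleType = Multiset.replicate m r := by
  have hsum := sum_cycleType σ
  constructor
  · intro h
    have hsupp : σ.support = Finset.univ := by
      refine Finset.eq_univ_iff_forall.mpr fun x => mem_support.mpr fun hx => hr.ne' ?_
      rw [← h x]
      exact Function.minimalPeriod_eq_one_iff_isFixedPt.mpr hx
    have hrep : σ.cycleType = Multiset.replicate σ.cycleType.card r := by
      refine Multiset.eq_replicate_card.mpr fun k hk => ?_
      obtain ⟨x, -, rfl⟩ := mem_cycleType_iff_exists_minimalPeriod.mp hk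
      exact h x
    rw [hrep, Multiset.sum_replicate, smul_eq_mul, hsupp, Finset.card_univ, hX, mul_comm] at hsum
    rw [hrep, Nat.eq_of_mul_eq_mul_left (by omega) hsum]
  · intro h x
    rw [h, Multiset.sum_replicate, smul_eq_mul, mul_comm, ← hX, eq_comm,
      Finset.card_eq_iff_eq_univ] at hsum
    refine Multiset.eq_of_mem_replicate (n := m) (h ▸ mem_cycleType_iff_exists_minimalPeriod.mpr ?_)
    exact ⟨x, hsum ▸ Finset.mem_univ x, rfl⟩

end CycleType

theorem zerosCount_one (X : Type*) : zerosCount 1 X = 1 := by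
  have hone (α : Perm X) : (∀ x, Function.minimalPeriod α x = 1) ↔ α = 1 := by
    simp only [Function.minimalPeriod_eq_one_iff_isFixedPt, Perm.ext_iff]
    rfl
  simp only [zerosCount, hone, Nat.card_unique]

theorem zerosCount_mul {X : Type*} [Fintype X] {r m : ℕ} (hr : 0 < r)
    (hX : Fintype.card X = r * m) :
    zerosCount r X * (r ^ m * m.factorial) = (r * m).factorial := by
  classical
  obtain rfl | hr : r = 1 ∨ 1 < r := by omega
  · simp [zerosCount_one]
  have hprod : ∏ n ∈ (Multiset.replicate m r).toFinset,
      ((Multiset.replicate m r).count n).factorial = m.factorial := by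
    rcases m.eq_zero_or_pos with rfl | hm
    · simp
    · rw [Multiset.toFinset_replicate, if_neg hm.ne', Finset.prod_singleton,
        Multiset.count_replicate_self]
  have hcard := card_of_cycleType_mul_eq X (Multiset.replicate m r)
  rw [if_pos ⟨by simp [hX, mul_comm], fun a ha => Multiset.eq_of_mem_replicate ha ▸ hr⟩,
    Multiset.sum_replicate, smul_eq_mul, mul_comm m, hX, Nat.sub_self, Nat.factorial_zero, one_mul,
    Multiset.prod_replicate, hprod] at hcard
  simp only [← hcard, zerosCount, forall_minimalPeriod_eq_iff_cycleType hr hX,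
    Nat.card_eq_fintype_card, Fintype.card_subtype]

variable {r d s : ℕ}

theorem connectedCount_eq_zero_of_not_dvd (h : ¬ r ∣ d) :
    connectedCount r (Fin d) (Fin s) = 0 := by
  have : IsEmpty {c : MonodromyData (Fin d) (Fin s) // IsCover r c ∧ IsConnectedCover c} :=
    ⟨fun ⟨_, hc, _⟩ => h ⟨_, by simpa using card_eq_mul_cycleCount hc.zeros⟩⟩
  exact Nat.card_of_isEmpty

theorem IsCover.cycleCount_eq (hr : 0 < r) {c : MonodromyData (Fin d) (Fin s)}
    (hc : IsCover r c) : cycleCount c.1 = d / r := by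
  have := card_eq_mul_cycleCount hc.zeros
  rw [Nat.card_eq_fintype_card, Fintype.card_fin] at this
  exact (Nat.div_eq_of_eq_mul_right hr this).symm

theorem connectedCount_eq_zero_of_lt (hr : 0 < r) (hd : 0 < d) (h : s + 1 < d / r) :
    connectedCount r (Fin d) (Fin s) = 0 := by
  have : Nonempty (Fin d) := ⟨⟨0, hd⟩⟩
  have : IsEmpty {c : MonodromyData (Fin d) (Fin s) // IsCover r c ∧ IsConnectedCover c} :=
    ⟨fun ⟨c, hc, hconn⟩ => by
      obtain ⟨g, hg⟩ := hconn.exists_genus hc.simple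
      have := cycleCount_pos (monodromyAtInfinity c)
      rw [hc.cycleCount_eq hr] at hg
      omega⟩
  exact Nat.card_of_isEmpty

end Counting

/-! ### Labelled poles -/

section Labelling

open Equiv Equiv.Perm

section

variable {X ι : Type*}

/-- A labelling of the cycles of `σ` by `ι`, as a function constant on cycles. -/
def IsLabelling (σ : Perm X) (ℓ : X → ι) : Prop :=
  (∀ x y, ℓ x = ℓ y ↔ σ.SameCycle x y) ∧ Function.Surjective ℓ

/-- Labellings of the cycles of `σ` as bijections from the set of cycles. -/
def labellingEquiv (σ : Perm X) :
    {ℓ : X → ι // IsLabelling σ ℓ} ≃ (Quotient (SameCycle.setoid σ) ≃ ι) where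
  toFun ℓ := Equiv.ofBijective (Quotient.lift ℓ.1 fun x y h => (ℓ.2.1 x y).mpr h)
    ⟨Quotient.ind₂ fun x y h => Quotient.sound ((ℓ.2.1 x y).mp h),
      Quotient.lift_surjective _ _ ℓ.2.2⟩
  invFun e := ⟨fun x => e ⟦x⟧, fun _ _ => e.injective.eq_iff.trans Quotient.eq,
    e.surjective.comp Quotient.mk_surjective⟩
  left_inv _ := rfl
  right_inv _ := Equiv.ext (Quotient.ind fun _ => rfl)

theorem card_isLabelling [Finite X] (σ : Perm X) (n : ℕ) :
    Nat.card {ℓ : X → Fin n // IsLabelling σ ℓ} = if cycleCount σ = n then n.factorial else 0 := by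
  classical
  rw [Nat.card_congr (labellingEquiv σ)]
  split_ifs with h
  · have := Fintype.ofFinite (Quotient (SameCycle.setoid σ))
    rw [cycleCount, Nat.card_eq_fintype_card] at h
    rw [Nat.card_eq_fintype_card, Fintype.card_equiv (Fintype.equivFinOfCardEq h), h]
  · have : IsEmpty (Quotient (SameCycle.setoid σ) ≃ Fin n) :=
      ⟨fun e => h ((Nat.card_congr e).trans (Nat.card_fin n))⟩
    exact Nat.card_of_isEmpty

end

/-- The number of connected coverings with `n` unlabelled poles. -/
def polesCount (r d s n : ℕ) : ℕ :=
  Nat.card {c : MonodromyData (Fin d) (Fin s) //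
    (IsCover r c ∧ IsConnectedCover c) ∧ cycleCount (monodromyAtInfinity c) = n}

/-- The number of connected coverings with labelled poles of orders `μ`. -/
def monodromyCount (r d s : ℕ) {n : ℕ} (μ : Fin n → ℕ) : ℕ :=
  Nat.card {p : MonodromyData (Fin d) (Fin s) × (Fin d → Fin n) //
    IsMonodromy r μ p.1.1 p.1.2 p.2}

theorem hurwitz_eq (r g : ℕ) {n : ℕ} (μ : Fin n → ℕ) : hurwitz r g μ =
    (monodromyCount r (∑ i, μ i) (simpleBranchPoints r g μ) μ : ℚ) /
      ((∑ i, μ i).factorial * (simpleBranchPoints r g μ).factorial) := by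
  rw [hurwitz, monodromyCount]
  congr 2
  exact (Nat.card_congr ((Equiv.prodAssoc _ _ _).subtypeEquiv fun _ => Iff.rfl)).symm

theorem card_labelled (r d s n : ℕ) :
    Nat.card {p : MonodromyData (Fin d) (Fin s) × (Fin d → Fin n) //
      (IsCover r p.1 ∧ IsConnectedCover p.1) ∧ IsLabelling (monodromyAtInfinity p.1) p.2} =
        n.factorial * polesCount r d s n := by
  classical
  have hfiber (c : MonodromyData (Fin d) (Fin s)) : Nat.card {ℓ : Fin d → Fin n //
      (IsCover r c ∧ IsConnectedCover c) ∧ IsLabelling (monodromyAtInfinity c) ℓ} =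
        if (IsCover r c ∧ IsConnectedCover c) ∧ cycleCount (monodromyAtInfinity c) = n
          then n.factorial else 0 := by
    by_cases hc : IsCover r c ∧ IsConnectedCover c
    · simp only [hc, true_and, card_isLabelling]
    · simp [hc]
  rw [Nat.card_congr (Equiv.subtypeProdEquivSigmaSubtype fun c ℓ =>
    (IsCover r c ∧ IsConnectedCover c) ∧ IsLabelling (monodromyAtInfinity c) ℓ), Nat.card_sigma]
  simp only [hfiber]
  rw [Finset.sum_ite, Finset.sum_const_zero, add_zero, Finset.sum_const, smul_eq_mul, mul_comm,
    polesCount, ← Fintype.card_subtype, ← Nat.card_eq_fintype_card]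

variable {r n d s : ℕ}

theorem isMonodromy_iff {μ : Fin n → ℕ} (hμ : ∀ i, 0 < μ i) {c : MonodromyData (Fin d) (Fin s)}
    {ℓ : Fin d → Fin n} : IsMonodromy r μ c.1 c.2 ℓ ↔
      ((IsCover r c ∧ IsConnectedCover c) ∧ IsLabelling (monodromyAtInfinity c) ℓ) ∧
        (fun i => Nat.card {x // ℓ x = i}) = μ := by
  constructor
  · intro h
    have hsurj : Function.Surjective ℓ := fun i => by
      obtain ⟨x, hx⟩ := (Nat.card_pos_iff.mp ((h.orders i).symm ▸ hμ i)).1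
      exact ⟨x, hx⟩
    exact ⟨⟨⟨⟨h.zeros, h.simple⟩, (isPretransitive_closure_iff c).mp h.connected⟩, h.poles, hsurj⟩,
      funext h.orders⟩
  · rintro ⟨⟨⟨hcover, hconn⟩, hpoles, -⟩, horders⟩
    exact ⟨hcover.zeros, hcover.simple, hpoles, congrFun horders,
      (isPretransitive_closure_iff c).mpr hconn⟩

theorem sum_monodromyCount (r d s n : ℕ) :
    ∑ μ ∈ Finset.finsuppAntidiag (Finset.univ : Finset (Fin n)) d,
      (if ∀ i, 0 < μ i then monodromyCount r d s μ else 0) = n.factorial * polesCount r d s n := by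
  let orders (p : MonodromyData (Fin d) (Fin s) × (Fin d → Fin n)) : Fin n →₀ ℕ :=
    Finsupp.equivFunOnFinite.symm fun i => Nat.card {x // p.2 x = i}
  have horders (p) : orders p ∈ Finset.finsuppAntidiag Finset.univ d := by
    refine Finset.mem_finsuppAntidiag.mpr ⟨?_, Finset.subset_univ _⟩
    simp only [orders, Finsupp.equivFunOnFinite_symm_apply_apply]
    rw [← Nat.card_sigma, Nat.card_congr (Equiv.sigmaFiberEquiv p.2), Nat.card_fin]
  rw [← card_labelled, card_subtype_eq_sum_fiberwise fun p _ => horders p]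
  refine Finset.sum_congr rfl fun μ _ => ?_
  split_ifs with hμ
  · simp only [monodromyCount, isMonodromy_iff hμ, orders, Equiv.symm_apply_eq]
    rfl
  · refine (Nat.card_eq_zero.mpr (Or.inl ⟨?_⟩)).symm
    rintro ⟨p, ⟨-, -, hsurj⟩, rfl⟩
    refine hμ fun i => ?_
    obtain ⟨x, hx⟩ := hsurj i
    exact Nat.card_pos_iff.mpr ⟨⟨x, hx⟩, inferInstance⟩

/-- The pairs `(g, n)` with `n ≥ 1` and `2g - 2 + n = m - 1`. -/
def genusPoles (m : ℕ) : Finset (ℕ × ℕ) :=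
  (Finset.range (m + 2) ×ˢ Finset.Icc 1 (m + 1)).filter fun p => 2 * p.1 + p.2 = m + 1

theorem mem_genusPoles {m : ℕ} {p : ℕ × ℕ} :
    p ∈ genusPoles m ↔ 1 ≤ p.2 ∧ 2 * p.1 + p.2 = m + 1 := by
  simp only [genusPoles, Finset.mem_filter, Finset.mem_product, Finset.mem_range, Finset.mem_Icc]
  omega

theorem sum_polesCount (hr : 0 < r) (hd : 0 < d) (m : ℕ) :
    ∑ p ∈ genusPoles m, polesCount r d (m + 1 + d / r - 2) p.2 =
      connectedCount r (Fin d) (Fin (m + 1 + d / r - 2)) := by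
  have : Nonempty (Fin d) := ⟨⟨0, hd⟩⟩
  set s := m + 1 + d / r - 2
  let poles (c : MonodromyData (Fin d) (Fin s)) : ℕ := cycleCount (monodromyAtInfinity c)
  have hmem (c : MonodromyData (Fin d) (Fin s)) (hc : IsCover r c ∧ IsConnectedCover c) :
      ((m + 1 - poles c) / 2, poles c) ∈ genusPoles m := by
    obtain ⟨g, hg⟩ := hc.2.exists_genus hc.1.simple
    have hpoles : 0 < poles c := cycleCount_pos _
    have hzeros : 0 < cycleCount c.1 := cycleCount_pos _
    rw [hc.1.cycleCount_eq hr] at hg hzeros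
    change 2 * g + poles c + d / r = m + 1 + d / r - 2 + 2 at hg
    refine mem_genusPoles.mpr ⟨hpoles, ?_⟩
    dsimp only
    omega
  rw [connectedCount, card_subtype_eq_sum_fiberwise hmem]
  refine Finset.sum_congr rfl fun p hp => ?_
  have hp := mem_genusPoles.mp hp
  have hfiber (c) : ((m + 1 - poles c) / 2, poles c) = p ↔ poles c = p.2 := by
    rw [Prod.ext_iff]
    dsimp only
    omega
  simp only [hfiber]
  rfl

end Labelling

section PartitionFunction

open PowerSeries

/-! ### Free energies as series in `x` -/

theorem hasSubst_const_X (n : ℕ) :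
    MvPowerSeries.HasSubst (fun _ : Fin n => (X : PowerSeries ℂ)) :=
  MvPowerSeries.hasSubst_of_constantCoeff_zero fun _ => constantCoeff_X

theorem coeff_subst_const_X {n : ℕ} (F : MvPowerSeries (Fin n) ℂ) (d : ℕ) :
    coeff d (MvPowerSeries.subst (fun _ : Fin n => (X : PowerSeries ℂ)) F : PowerSeries ℂ) =
      ∑ μ ∈ Finset.finsuppAntidiag Finset.univ d, MvPowerSeries.coeff μ F := by
  have hmonomial (μ : Fin n →₀ ℕ) : MvPowerSeries.coeff (Finsupp.single () d)
      (μ.prod fun _ e => (X : PowerSeries ℂ) ^ e) = if d = ∑ i, μ i then 1 else 0 := by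
    rw [Finsupp.prod_fintype _ _ fun _ => pow_zero _, Finset.prod_pow_eq_pow_sum]
    exact coeff_X_pow d _
  refine (MvPowerSeries.coeff_subst (hasSubst_const_X n) F (Finsupp.single () d)).trans ?_
  simp_rw [hmonomial]
  rw [finsum_eq_sum_of_support_subset (s := Finset.finsuppAntidiag Finset.univ d)]
  · refine Finset.sum_congr rfl fun μ hμ => ?_
    rw [if_pos (Finset.mem_finsuppAntidiag.mp hμ).1.symm, smul_eq_mul, mul_one]
  · intro μ hμ
    refine Finset.mem_coe.mpr (Finset.mem_finsuppAntidiag.mpr ⟨?_, Finset.subset_univ _⟩)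
    by_contra hne
    exact hμ (by dsimp only; rw [if_neg fun h => hne h.symm, smul_zero])

theorem freeEnergyDiag_eq_subst (r g n : ℕ) : freeEnergyDiag r g n =
    PowerSeries.subst (lambertX r)
      (MvPowerSeries.subst (fun _ : Fin n => (X : PowerSeries ℂ)) (freeEnergyX r g n)) := by
  have hX := hasSubst_const_X n
  have hx : PowerSeries.HasSubst (lambertX r) :=
    .of_constantCoeff_zero' (constantCoeff_lambertX r)
  have hxi : MvPowerSeries.HasSubst fun i : Fin n =>
      PowerSeries.subst (MvPowerSeries.X i : MvPowerSeries (Fin n) ℂ) (lambertX r) :=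
    MvPowerSeries.hasSubst_of_constantCoeff_zero fun i =>
      PowerSeries.constantCoeff_subst_eq_zero (MvPowerSeries.constantCoeff_X i) _
        (constantCoeff_lambertX r)
  rw [freeEnergyDiag, freeEnergy, MvPowerSeries.subst_comp_subst_apply hxi hX, PowerSeries.subst,
    MvPowerSeries.subst_comp_subst_apply hX hx.const]
  congr 1
  funext i
  have hxX : MvPowerSeries.subst (fun _ : Unit => lambertX r) (X : PowerSeries ℂ) = lambertX r :=
    subst_X hx
  rw [hxX, PowerSeries.subst,
    MvPowerSeries.subst_comp_subst_apply (PowerSeries.HasSubst.X i).const hX]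
  simp_rw [MvPowerSeries.subst_X hX]
  exact X_subst (lambertX r)

theorem coeff_subst_const_X_freeEnergyX (r g n d : ℕ) :
    coeff d (MvPowerSeries.subst (fun _ : Fin n => (X : PowerSeries ℂ)) (freeEnergyX r g n) :
      PowerSeries ℂ) =
      n.factorial * polesCount r d (2 * g + n + d / r - 2) n /
        (d.factorial * (2 * g + n + d / r - 2).factorial) := by
  have hcoeff : ∀ μ ∈ Finset.finsuppAntidiag (Finset.univ : Finset (Fin n)) d,
      MvPowerSeries.coeff μ (freeEnergyX r g n) =
        ((if ∀ i, 0 < μ i then monodromyCount r d (2 * g + n + d / r - 2) μ else 0 : ℕ) : ℂ) /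
        (d.factorial * (2 * g + n + d / r - 2).factorial) := fun μ hμ => by
    change (if ∀ i, 0 < μ i then (hurwitz r g μ : ℂ) else 0) = _
    split_ifs
    · rw [hurwitz_eq, simpleBranchPoints, (Finset.mem_finsuppAntidiag.mp hμ).1]
      push_cast
      rfl
    · simp
  rw [coeff_subst_const_X, Finset.sum_congr rfl hcoeff, ← Finset.sum_div, ← Nat.cast_sum,
    sum_monodromyCount]
  push_cast
  rfl

theorem polesCount_zero_degree (r s : ℕ) {n : ℕ} (hn : 0 < n) : polesCount r 0 s n = 0 := by
  refine Nat.card_eq_zero.mpr (Or.inl ⟨?_⟩)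
  rintro ⟨c, -, rfl⟩
  exact hn.ne' (Nat.card_eq_zero.mpr (Or.inl ⟨Quotient.ind fun x => x.elim0⟩))

/-- The series `S_m` in the variable `x`. In degree `d` there are `m - 1 + d / r` simple branch
points; the degree `0` is set apart because the empty covering counts as connected. -/
def connectedSeries (r m : ℕ) : PowerSeries ℂ :=
  .mk fun d => if d = 0 then 0 else
    connectedCount r (Fin d) (Fin (m + 1 + d / r - 2)) /
      (d.factorial * (m + 1 + d / r - 2).factorial)

theorem constantCoeff_connectedSeries (r m : ℕ) : constantCoeff (connectedSeries r m) = 0 := by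
  rw [← coeff_zero_eq_constantCoeff_apply, connectedSeries, coeff_mk, if_pos rfl]

variable {r : ℕ}

theorem connectedSeries_eq_sum (hr : 0 < r) (m : ℕ) : connectedSeries r m =
    ∑ p ∈ genusPoles m, (p.2.factorial : ℂ)⁻¹ •
      (MvPowerSeries.subst (fun _ : Fin p.2 => (X : PowerSeries ℂ)) (freeEnergyX r p.1 p.2) :
        PowerSeries ℂ) := by
  ext d
  have hterm : ∀ p ∈ genusPoles m, coeff d ((p.2.factorial : ℂ)⁻¹ •
      (MvPowerSeries.subst (fun _ : Fin p.2 => (X : PowerSeries ℂ)) (freeEnergyX r p.1 p.2) :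
        PowerSeries ℂ)) = (polesCount r d (m + 1 + d / r - 2) p.2 : ℂ) /
          (d.factorial * (m + 1 + d / r - 2).factorial) := fun p hp => by
    rw [coeff_smul, coeff_subst_const_X_freeEnergyX, (mem_genusPoles.mp hp).2, smul_eq_mul,
      mul_div_assoc, inv_mul_cancel_left₀ (Nat.cast_ne_zero.mpr (Nat.factorial_ne_zero _))]
  rw [map_sum, Finset.sum_congr rfl hterm, ← Finset.sum_div, ← Nat.cast_sum, connectedSeries,
    coeff_mk]
  split_ifs with hd
  · subst hd
    rw [Finset.sum_eq_zero fun p hp => polesCount_zero_degree _ _ (mem_genusPoles.mp hp).1,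
      Nat.cast_zero, zero_div]
  · rw [sum_polesCount hr (Nat.pos_of_ne_zero hd)]

theorem freeEnergyS_eq_subst (hr : 0 < r) (m : ℕ) :
    freeEnergyS r m = (connectedSeries r m).subst (lambertX r) := by
  have hx : HasSubst (lambertX r) := .of_constantCoeff_zero' (constantCoeff_lambertX r)
  rw [connectedSeries_eq_sum hr, ← coe_substAlgHom hx, map_sum]
  refine Finset.sum_congr rfl fun p _ => ?_
  rw [map_smul, coe_substAlgHom hx, freeEnergyDiag_eq_subst]

theorem constantCoeff_freeEnergyS (hr : 0 < r) (m : ℕ) : constantCoeff (freeEnergyS r m) = 0 := by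
  rw [freeEnergyS_eq_subst hr,
    constantCoeff_subst_of_constantCoeff_zero (constantCoeff_lambertX r),
    constantCoeff_connectedSeries]

theorem phase_subst {a : PowerSeries ℂ} (ha : constantCoeff a = 0) (S : ℕ → PowerSeries ℂ) :
    phase (fun m => (S m).subst a) = (phase S).subst (emb a) := by
  ext1 d
  have hcoeff : (PowerSeries.mk fun m => coeff d ((S m).subst a)) =
      ∑ k ∈ Finset.range (d + 1),
        C (coeff d (a ^ k)) * (PowerSeries.mk fun m => coeff k (S m)) := by
    ext m
    rw [coeff_mk, coeff_subst_eq_sum ha, map_sum]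
    refine Finset.sum_congr rfl fun k _ => ?_
    rw [coeff_C_mul, coeff_mk, mul_comm]
  rw [coeff_subst_emb ha, phase, coeff_mk, hcoeff, map_sum, Finset.mul_sum]
  refine Finset.sum_congr rfl fun k _ => ?_
  rw [phase, coeff_mk, map_mul, HahnSeries.ofPowerSeries_C, mul_left_comm]

/-! ### The exponential formula -/

/-- The exponential generating function, in the number of simple branch points, of the
coverings of degree `d`. -/
def coverGF (r d : ℕ) : PowerSeries ℂ :=
  .mk fun s => coverCount r (Fin d) (Fin s) / (d.factorial * s.factorial)

/-- The exponential generating function, in the number of simple branch points, of the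
connected coverings of degree `d`. -/
def connectedGF (r d : ℕ) : PowerSeries ℂ :=
  .mk fun s => connectedCount r (Fin d) (Fin s) / (d.factorial * s.factorial)

theorem choose_div_factorial {k d : ℕ} (hk : k ≤ d) :
    (d.choose k : ℂ) / d.factorial = 1 / (k.factorial * (d - k).factorial) := by
  rw [Nat.cast_choose ℂ hk, div_div_cancel_left' (Nat.cast_ne_zero.mpr (Nat.factorial_ne_zero d)),
    one_div]

theorem natCast_mul_coverGF (r d : ℕ) : (d : PowerSeries ℂ) * coverGF r d =
    ∑ p ∈ Finset.HasAntidiagonal.antidiagonal d,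
      (p.1 : PowerSeries ℂ) * (connectedGF r p.1 * coverGF r p.2) := by
  have hcast (k : ℕ) (f : PowerSeries ℂ) (s : ℕ) :
      coeff s ((k : PowerSeries ℂ) * f) = k * coeff s f := by
    rw [← map_natCast (C : ℂ →+* PowerSeries ℂ) k, coeff_C_mul]
  ext s
  rw [hcast, coverGF, coeff_mk, map_sum, ← mul_div_assoc, ← Nat.cast_mul, mul_coverCount,
    Finset.Nat.sum_antidiagonal_eq_sum_range_succ_mk]
  push_cast
  rw [Finset.sum_div]
  refine Finset.sum_congr rfl fun k hk => ?_
  rw [hcast, coeff_mul, Finset.Nat.sum_antidiagonal_eq_sum_range_succ_mk, Finset.sum_div,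
    Finset.mul_sum]
  refine Finset.sum_congr rfl fun t ht => ?_
  rw [mul_div_right_comm, mul_div_mul_comm,
    choose_div_factorial (Finset.mem_range_succ_iff.mp hk),
    choose_div_factorial (Finset.mem_range_succ_iff.mp ht)]
  simp only [connectedGF, coverGF, coeff_mk]
  ring

theorem connectedGF_eq_zero {d : ℕ} (h : ¬ r ∣ d) : connectedGF r d = 0 := by
  ext s
  simp [connectedGF, connectedCount_eq_zero_of_not_dvd h]

theorem coverGF_eq_zero {d : ℕ} (h : ¬ r ∣ d) : coverGF r d = 0 := by
  ext s
  simp [coverGF, coverCount_eq, zerosCount_eq_zero (X := Fin d) (by simpa using h)]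

theorem coverGF_mul (hr : 0 < r) (m : ℕ) : coverGF r (r * m) =
    C ((r : ℂ) ^ m * m.factorial)⁻¹ * rescale ((r * m).choose 2 : ℂ) (exp ℂ) := by
  ext s
  have hzeros : (zerosCount r (Fin (r * m)) : ℂ) * ((r : ℂ) ^ m * m.factorial) =
      (r * m).factorial := mod_cast zerosCount_mul hr (Fintype.card_fin _)
  have hfactorial : ((r * m).factorial : ℂ) ≠ 0 := Nat.cast_ne_zero.mpr (Nat.factorial_ne_zero _)
  have hzeros_div : (zerosCount r (Fin (r * m)) : ℂ) / (r * m).factorial =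
      ((r : ℂ) ^ m * m.factorial)⁻¹ := by
    rw [← hzeros] at hfactorial ⊢
    rw [div_mul_cancel_left₀ (left_ne_zero_of_mul hfactorial)]
  rw [coverGF, coeff_mk, coeff_C_mul, coeff_rescale, coeff_exp, coverCount_eq, Nat.cast_mul,
    mul_div_mul_comm, hzeros_div]
  simp [div_eq_mul_inv]

theorem coverGF_zero (hr : 0 < r) : coverGF r 0 = 1 := by
  simpa using coverGF_mul hr 0

/-- `ħ^{-a}`. -/
def hbarInvPow (a : ℕ) : LaurentSeries ℂ := HahnSeries.single (-(a : ℤ)) 1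

theorem hbarInvPow_add (a b : ℕ) : hbarInvPow (a + b) = hbarInvPow a * hbarInvPow b := by
  rw [hbarInvPow, hbarInvPow, hbarInvPow, HahnSeries.single_mul_single, one_mul, Nat.cast_add,
    neg_add]

theorem hbar_mul_hbarInvPow_succ (m : ℕ) : hbar * hbarInvPow (m + 1) = hbarInvPow m := by
  rw [hbar, hbarInvPow, hbarInvPow, HahnSeries.single_mul_single, one_mul, Nat.cast_succ,
    neg_add_rev, add_neg_cancel_left]

theorem eulerLaurent_hbarInvPow (m : ℕ) :
    eulerLaurent (hbarInvPow m) = -(HahnSeries.C (m : ℂ) * hbarInvPow m) := by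
  ext j
  rw [HahnSeries.coeff_neg, laurent_coeff_C_mul, coeff_eulerLaurent, hbarInvPow,
    HahnSeries.coeff_single]
  split_ifs with hj
  · simp [hj]
  · simp

theorem coeff_phase_connectedSeries (hr : 0 < r) {d : ℕ} (hd : 0 < d) :
    coeff d (phase (connectedSeries r)) =
      hbarInvPow (d / r) * HahnSeries.ofPowerSeries ℤ ℂ (connectedGF r d) := by
  ext j
  rw [phase, coeff_mk, hbarInvPow, HahnSeries.coeff_single_mul, HahnSeries.coeff_single_mul,
    sub_neg_eq_add, sub_neg_eq_add, one_mul, one_mul]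
  by_cases hdvd : r ∣ d
  · have hsheets : 1 ≤ d / r := Nat.div_pos (Nat.le_of_dvd hd hdvd) hr
    rcases lt_or_ge (j + 1) 0 with hj | hj
    · rw [ofPowerSeries_coeff_of_neg _ hj]
      rcases lt_or_ge (j + (d / r : ℕ)) 0 with hs | hs
      · rw [ofPowerSeries_coeff_of_neg _ hs]
      · lift j + (d / r : ℕ) to ℕ using hs with s hjs
        rw [HahnSeries.ofPowerSeries_apply_coeff, connectedGF, coeff_mk,
          connectedCount_eq_zero_of_lt hr hd (by omega), Nat.cast_zero, zero_div]
    · lift j + 1 to ℕ using hj with m hm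
      have hs : j + (d / r : ℕ) = (m + 1 + d / r - 2 : ℕ) := by omega
      rw [hs, HahnSeries.ofPowerSeries_apply_coeff, HahnSeries.ofPowerSeries_apply_coeff,
        coeff_mk, connectedSeries, connectedGF, coeff_mk, coeff_mk, if_neg hd.ne']
  · have hzero : (PowerSeries.mk fun m => coeff d (connectedSeries r m)) = 0 := by
      ext m
      simp [connectedSeries, connectedCount_eq_zero_of_not_dvd hdvd]
    rw [connectedGF_eq_zero hdvd, hzero]
    simp

/-- The partition function in the variable `x`. -/
def partitionX (r : ℕ) : Fun :=
  .mk fun d => hbarInvPow (d / r) * HahnSeries.ofPowerSeries ℤ ℂ (coverGF r d)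

theorem constantCoeff_partitionX (hr : 0 < r) : constantCoeff (partitionX r) = 1 := by
  rw [← coeff_zero_eq_constantCoeff_apply, partitionX, coeff_mk, coverGF_zero hr, Nat.zero_div,
    map_one, mul_one]
  rfl

theorem eulerX_partitionX (hr : 0 < r) :
    eulerX (partitionX r) = eulerX (phase (connectedSeries r)) * partitionX r := by
  ext1 d
  have hcast (k : ℕ) (f : PowerSeries ℂ) : (k : LaurentSeries ℂ) * HahnSeries.ofPowerSeries ℤ ℂ f =
      HahnSeries.ofPowerSeries ℤ ℂ ((k : PowerSeries ℂ) * f) := by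
    rw [map_mul, map_natCast]
  rw [coeff_eulerX, coeff_mul, partitionX, coeff_mk, mul_left_comm, hcast, natCast_mul_coverGF,
    map_sum, Finset.mul_sum]
  refine Finset.sum_congr rfl fun p hp => ?_
  rw [coeff_eulerX, coeff_mk, ← hcast, map_mul]
  rcases Nat.eq_zero_or_pos p.1 with hzero | hpos
  · simp [hzero]
  · rw [coeff_phase_connectedSeries hr hpos]
    by_cases hdvd : r ∣ p.1
    · rw [← Finset.HasAntidiagonal.mem_antidiagonal.mp hp, Nat.add_div_of_dvd_right hdvd,
        hbarInvPow_add]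
      ring
    · simp [connectedGF_eq_zero hdvd]

theorem fexp_phase_connectedSeries (hr : 0 < r) :
    fexp (phase (connectedSeries r)) = partitionX r := by
  refine (eq_fexp_of_derivative_eq_mul (constantCoeff_phase (constantCoeff_connectedSeries r))
    (constantCoeff_partitionX hr) (X_mul_cancel ?_)).symm
  rw [← mul_assoc]
  exact eulerX_partitionX hr

theorem partitionFunction_eq_subst (hr : 0 < r) :
    partitionFunction r = (partitionX r).subst (emb (lambertX r)) := by
  rw [partitionFunction, funext (freeEnergyS_eq_subst hr), phase_subst (constantCoeff_lambertX r),
    ← subst_fexp (constantCoeff_emb_lambertX r)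
      (constantCoeff_phase (constantCoeff_connectedSeries r)), fexp_phase_connectedSeries hr]

/-! ### The quantum curve equations -/

theorem coeff_partitionX_mul (hr : 0 < r) (m : ℕ) : coeff (r * m) (partitionX r) =
    HahnSeries.C ((r : ℂ) ^ m * m.factorial)⁻¹ * hbarInvPow m *
      expHbar (r * m * (r * m - 1) / 2) := by
  rw [partitionX, coeff_mk, coverGF_mul hr, Nat.mul_div_cancel_left _ hr, map_mul,
    HahnSeries.ofPowerSeries_C, Nat.cast_choose_two, expHbar, Nat.cast_mul]
  ring

theorem coeff_partitionX_eq_zero {d : ℕ} (h : ¬ r ∣ d) : coeff d (partitionX r) = 0 := by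
  rw [partitionX, coeff_mk, coverGF_eq_zero h, map_zero, mul_zero]

theorem hbar_mul_coeff_partitionX_succ (hr : 0 < r) (m : ℕ) :
    hbar * ((r * (m + 1) : ℕ) * coeff (r * (m + 1)) (partitionX r)) =
      expHbar ((r : ℂ) * ((r : ℂ) - 1) / 2 + (r * m : ℕ) * r) * coeff (r * m) (partitionX r) := by
  have hr' : (r : ℂ) ≠ 0 := Nat.cast_ne_zero.mpr hr.ne'
  have hm : (m : ℂ) + 1 ≠ 0 := Nat.cast_add_one_ne_zero m
  have hexponent : (r : ℂ) * (m + 1 : ℕ) * (r * (m + 1 : ℕ) - 1) / 2 =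
      (r * (r - 1) / 2 + (r * m : ℕ) * r) + r * m * (r * m - 1) / 2 := by
    push_cast
    ring
  have hscalar : ((r : ℂ) ^ m * m.factorial)⁻¹ =
      (r * (m + 1) : ℕ) * ((r : ℂ) ^ (m + 1) * (m + 1).factorial)⁻¹ := by
    rw [Nat.factorial_succ]
    push_cast
    field_simp
    rw [pow_succ]
  rw [coeff_partitionX_mul hr, coeff_partitionX_mul hr, hexponent, expHbar_add, hscalar, map_mul,
    map_natCast, ← hbar_mul_hbarInvPow_succ m]
  ring

theorem opPX_partitionX (hr : 0 < r) : opPX r (partitionX r) = 0 := by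
  ext1 d
  rw [coeff_opPX, map_zero]
  by_cases hdvd : r ∣ d
  · obtain ⟨m, rfl⟩ := hdvd
    cases m with
    | zero => simp [hr.ne']
    | succ m =>
      have hsub : r * (m + 1) - r = r * m := by rw [Nat.mul_succ, Nat.add_sub_cancel]
      rw [if_pos (Nat.le_mul_of_pos_right r m.succ_pos), hsub,
        hbar_mul_coeff_partitionX_succ hr, sub_self]
  · rw [coeff_partitionX_eq_zero hdvd]
    split_ifs with hle
    · rw [coeff_partitionX_eq_zero fun h => hdvd ((Nat.dvd_sub_iff_left hle dvd_rfl).mp h)]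
      simp
    · simp

theorem opQX_partitionX (hr : 0 < r) : opQX r (partitionX r) = 0 := by
  ext1 d
  rw [coeff_opQX, map_zero]
  by_cases hdvd : r ∣ d
  · obtain ⟨m, rfl⟩ := hdvd
    have hdiv : ((r * m : ℕ) : ℂ) / r = m := by
      rw [Nat.cast_mul, mul_div_cancel_left₀ _ (Nat.cast_ne_zero.mpr hr.ne')]
    rw [coeff_partitionX_mul hr, eulerLaurent_mul, eulerLaurent_mul, eulerLaurent_C,
      eulerLaurent_expHbar, eulerLaurent_hbarInvPow, hdiv, Nat.cast_mul]
    ring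
  · rw [coeff_partitionX_eq_zero hdvd, mul_zero, map_zero, sub_zero]

theorem opP_partitionFunction (hr : 0 < r) : opP r (partitionFunction r) = 0 := by
  rw [partitionFunction_eq_subst hr, opP_subst hr, opPX_partitionX hr,
    ← coe_substAlgHom (hasSubst_emb_lambertX r), map_zero]

theorem opQ_partitionFunction (hr : 0 < r) : opQ r (partitionFunction r) = 0 := by
  rw [partitionFunction_eq_subst hr, opQ_subst hr, opQX_partitionX hr,
    ← coe_substAlgHom (hasSubst_emb_lambertX r), map_zero]

/-! ### The spectral curve -/

theorem freeEnergyS_zero (r : ℕ) : freeEnergyS r 0 = freeEnergyDiag r 0 1 := by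
  have hpoles : genusPoles 0 = {(0, 1)} := by decide
  change ∑ p ∈ genusPoles 0, _ = _
  simp [hpoles]

theorem constantCoeff_freeEnergyDiag (hr : 0 < r) : constantCoeff (freeEnergyDiag r 0 1) = 0 := by
  rw [← freeEnergyS_zero, constantCoeff_freeEnergyS hr]

theorem opD_freeEnergyDiag (hr : 0 < r) : opD r ℂ (freeEnergyDiag r 0 1) = X ^ r := by
  rw [← freeEnergyS_zero, ← onLambertCurve_iff hr,
    onLambertCurve_iff_sub_eq_zero (constantCoeff_opD _)]
  have hlim := semiclassicalLimit_opP hr (freeEnergyS r) (constantCoeff_freeEnergyS hr)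
  rw [← partitionFunction, opP_partitionFunction hr, mul_zero] at hlim
  refine ⟨?_, constantCoeff_opD _⟩
  ext d
  simpa using (hlim d).2.symm

theorem coeff_freeEnergyDiag (hr : 0 < r) : coeff r (freeEnergyDiag r 0 1) = 1 / (r : ℂ) := by
  rw [eq_div_iff (Nat.cast_ne_zero.mpr hr.ne'), mul_comm, ← coeff_self_opD, opD_freeEnergyDiag hr,
    coeff_X_pow_self]

end PartitionFunction

end

end OrbifoldHurwitz

open OrbifoldHurwitz in
theorem theorem1p2 (r : ℕ) (hr : 0 < r) :
    -- the two differential equations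
    opP r (partitionFunction r) = 0 ∧
    opQ r (partitionFunction r) = 0 ∧
    -- `D = x ∂/∂x`
    (∀ f : Fun, opD r (LaurentSeries ℂ) (PowerSeries.subst (emb (lambertX r)) f) =
      PowerSeries.subst (emb (lambertX r))
        (PowerSeries.X * PowerSeries.derivative (LaurentSeries ℂ) f)) ∧
    -- the commutator relation
    opP r * opQ r - opQ r * opP r = opP r ∧
    -- the semi-classical limit of the first equation, and the curve it recovers
    IsSemiclassicalLimit (opP r) 0 (fun S =>
      opD r ℂ S - lambertX r ^ r * fexp (PowerSeries.C (r : ℂ) * opD r ℂ S)) ∧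
    (∀ S : PowerSeries ℂ, PowerSeries.constantCoeff S = 0 →
      (opD r ℂ S - lambertX r ^ r * fexp (PowerSeries.C (r : ℂ) * opD r ℂ S) = 0 ↔
        OnLambertCurve r (opD r ℂ S))) ∧
    -- the semi-classical limit of the second equation, and the curve it recovers
    IsSemiclassicalLimit (opQ r) (-1) (fun S =>
      (1 / 2 : ℂ) • opD r ℂ S ^ 2 - (1 / (r : ℂ)) • opD r ℂ S + S) ∧
    (∀ S : PowerSeries ℂ, PowerSeries.constantCoeff S = 0 →
      ((1 / 2 : ℂ) • opD r ℂ S ^ 2 - (1 / (r : ℂ)) • opD r ℂ S + S = 0 ↔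
        ∃ c : ℂ, c • lambertX r ^ r =
          opD r ℂ S * fexp (-(PowerSeries.C (r : ℂ) * opD r ℂ S)))) ∧
    (∀ S : PowerSeries ℂ, PowerSeries.constantCoeff S = 0 →
      ((1 / 2 : ℂ) • opD r ℂ S ^ 2 - (1 / (r : ℂ)) • opD r ℂ S + S = 0 ∧
          PowerSeries.coeff r S = 1 / (r : ℂ) ↔
        OnLambertCurve r (opD r ℂ S))) ∧
    -- the leading term `S₀ = F_{0,1}` of the partition function gives the curve `y = z^r`
    freeEnergyS r 0 = freeEnergyDiag r 0 1 ∧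
    PowerSeries.constantCoeff (freeEnergyDiag r 0 1) = 0 ∧
    PowerSeries.coeff r (freeEnergyDiag r 0 1) = 1 / (r : ℂ) ∧
    opD r ℂ (freeEnergyDiag r 0 1) = PowerSeries.X ^ r ∧
    (∀ y : PowerSeries ℂ, OnLambertCurve r y ∧ PowerSeries.constantCoeff y = 0 ↔
      y = PowerSeries.X ^ r) := by
  exact ⟨opP_partitionFunction hr, opQ_partitionFunction hr, opD_subst_emb_lambertX hr,
    commutator hr, semiclassicalLimit_opP hr,
    fun S _ => (onLambertCurve_iff_sub_eq_zero (constantCoeff_opD S)).symm,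
    semiclassicalLimit_opQ r, fun S hS => half_sq_sub_eq_zero_iff hr hS,
    fun S hS => half_sq_sub_eq_zero_and_coeff_iff hr hS, freeEnergyS_zero r,
    constantCoeff_freeEnergyDiag hr, coeff_freeEnergyDiag hr, opD_freeEnergyDiag hr,
    onLambertCurve_iff hr⟩
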